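/- **Setting.** Fix integers $Q,N\ge 1$; $q,r$ range over $1,\dots,Q$ and $k$ over $1,\dots,N$. Let $\mathcal Q(x)=\frac1{\sqrt{2\pi}}\int_x^\infty e^{-u^2/2}\,du$, with inverse $\mathcal Q^{-1}$ on $(0,1)$. The data are: complex channels $H_{qr}(k)$ with $H_{qq}(k)\ne 0$; noise levels $\sigma_{q,k}^2>0$; reals $\mu_{q,k|0},\mu_{q,k|1}$ and $\sigma_{q,k|0},\sigma_{q,k|1}>0$; $f_q>0$; $0<\tau_q^{\min}<\tau_q^{\max}<T_q$; $\alpha_{q,k},\beta_q\in(0,1/2]$; $P_q,p^{\max}_{q,k},w_{q,k},I_q^{\max}>0$; $I^{\max}\in\mathbb R$; $c\ge 0$. Put $\hat\sigma_{q,k}^2=\sigma_{q,k}^2/|H_{qq}(k)|^2$, $\hat H_{qr}(k)=H_{qr}(k)/H_{qq}(k)$ and $\hat\alpha_{q,k}=\mathcal Q^{-1}(1-\alpha_{q,k})$. A strategy of player $q$ is $x_q=(\hat\tau_q,p_q,P_q^{\rm fa})\in\mathbb R\times\mathbb R^N\times\mathbb R$. Let $$P^{\rm miss}_{q,k}(x_q)=1-\mathcal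 Q\Big(\tfrac{\sigma_{q,k|0}\mathcal Q^{-1}(P_q^{\rm fa})-(\mu_{q,k|1}-\mu_{q,k|0})\hat\tau_q}{\sigma_{q,k|1}}\Big),\qquad r_q(p)=\sum_k\log\Big(1+\tfrac{p_{q,k}}{\hat\sigma_{q,k}^2+\sum_{r\neq q}|\hat H_{qr}(k)|^2p_{r,k}}\Big),$$ $$\theta_q(x)=\log\Big(\big(1-\tfrac{\hat\tau_q^2}{f_qT_q}\big)(1-P_q^{\rm fa})\,r_q(p)\Big)-\frac c2\Big(\tfrac{\hat\tau_q}{\sqrt{f_q}}-\tfrac1Q\sum_r\tfrac{\hat\tau_r}{\sqrt{f_r}}\Big)^2\quad(\log 0=-\infty),$$ $$I_q(x_q)=\sum_kP^{\rm miss}_{q,k}(x_q)w_{q,k}p_{q,k}-I_q^{\max},\qquad I(x)=\sum_{k}\sum_{q}P^{\rm miss}_{q,k}(x_q)w_{q,k}p_{q,k}-I^{\max}.$$ Let $\mathcal P_q=\{p\in\mathbb R^N:\sum_kp_k\le P_q,\ 0\le p_k\le p_{q,k}^{\max}\}$. Let $\mathcal Y_q$ be the set of $x_q$ with $p_q\in\mathcal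 P_q$, $\sqrt{\tau_q^{\min}f_q}\le\hat\tau_q\le\sqrt{\tau_q^{\max}f_q}$, $0<P_q^{\rm fa}\le\beta_q$ and $\frac{\sigma_{q,k|0}}{\sigma_{q,k|1}}\mathcal Q^{-1}(P_q^{\rm fa})-\hat\tau_q\frac{\mu_{q,k|1}-\mu_{q,k|0}}{\sigma_{q,k|1}}\le\hat\alpha_{q,k}$ for all $k$. Let $\mathcal X_q=\{x_q\in\mathcal Y_q: I_q(x_q)\le0\}$, assumed nonempty, $\mathcal Y=\prod_q\mathcal Y_q$ and $\mathcal Y_{-q}=\prod_{r\ne q}\mathcal Y_r$. For a fixed price $\pi\ge0$, in the game $\mathcal G_\pi$ player $q$ maximizes $\theta_q(x_q,x_{-q})-\pi I(x_q,x_{-q})$ over $x_q\in\mathcal X_q$; an NE is a profile $x$ in which every $x_q$ is optimal given $x_{-q}$. **The matrix $\Gamma(t)$.** Fix $t>0$. For every $q$ fix $p_q^{\rm ref}\in\mathcal P_q\setminus\{0\}$ with $\sum_kw_{q,k}p^{\rm ref}_{q,k}\le2I_q^{\max}$. Put $P_q^{\rm ref}=\max_k\mathcal Q\big((\sigma_{q,k|1}\hat\alpha_{q,k}+(\mu_{q,k|1}-\mu_{q,k|0})\sqrt{f_q\tau_q^{\min}})/\sigma_{q,k|0}\big)$,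 $$\eta_q(t)=\log\big(1-\tfrac{\tau_q^{\max}}{T_q}\big)+\log(1-P_q^{\rm ref})+\log\sum_k\log\Big(1+\tfrac{p^{\rm ref}_{q,k}}{\hat\sigma^2_{q,k}+\sum_{r\ne q}|\hat H_{qr}(k)|^2p^{\max}_{r,k}}\Big)-\frac t2\sum_kw_{q,k}p^{\rm ref}_{q,k},$$ $\hat{\mathcal Y}_q^t=\{x_q\in\mathcal Y_q:\sum_kp_{q,k}\ge(\min_k\hat\sigma^2_{q,k})e^{\eta_q(t)}\}$, and $$\lambda^{\max}=\sum_q\frac{1/\min_{r}\min\{I_r^{\max},\min_kp^{\max}_{r,k}\}}{\Big[\min_k\frac1{p^{\max}_{q,k}}\log\Big(1+\frac{p^{\max}_{q,k}}{\hat\sigma_{q,k}^2+\sum_{r\ne q}|\hat H_{qr}(k)|^2p_{r,k}^{\max}}\Big)\Big]\min_k\hat\sigma_{q,k}^2}.$$ With $\mathcal L_q=-\theta_q+\lambda I_q+\mu I$, write $z_q=(p_q,P^{\rm fa}_q)$ and let $$B_q(x,\lambda,\mu)=\begin{bmatrix}\nabla^2_{\hat\tau_q}\mathcal L_q|_{c=0}&-\|\nabla^2_{\hat\tau_qz_q}\mathcal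 L_q\|\\-\|\nabla^2_{z_q\hat\tau_q}\mathcal L_q\|&\lambda_{\rm least}(\nabla^2_{z_q}\mathcal L_q)\end{bmatrix},$$ where $\|\cdot\|$ is the spectral norm and $\lambda_{\rm least}$ the least eigenvalue. Let $\rho_q(t)\ge0$ be the positive part of the minimum of $\lambda_{\rm least}(B_q(x,\lambda,\mu))$ over $x_q\in\hat{\mathcal Y}_q^t$, $x_{-q}\in\mathcal Y_{-q}$, $\lambda\in[0,\lambda^{\max}]$, $\mu\in[0,t]$. Let $D_q=\mathrm{diag}\Big(\sqrt{\rho_q(t)+c\,\tfrac{(1-1/Q)^2}{f_q}},\sqrt{\rho_q(t)}\Big)$, $E_{qr}(x)=\mathrm{diag}\big(|\nabla^2_{\hat\tau_q\hat\tau_r}\theta_q|,\|\nabla^2_{p_qp_r}\theta_q\|\big)$ and, for $r\neq q$, $\beta_{qr}(t,c)=\max\{\|D_q^{-1}E_{qr}(x)D_r^{-1}\|:x_q\in\hat{\mathcal Y}_q^t,\ x_{-q}\in\mathcal Y_{-q}\}$. The $Q\times Q$ matrix $\Gamma(t)$ has unit diagonal and off-diagonal entries $-\beta_{qr}(t,c)$.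 **Theorem.** Let $0\le\pi\le t$. Suppose that either $c=0$, or all players have the same $\tau_q^{\min}$ and the same $\tau_q^{\max}$ and $P_q^{\rm ref}\le\beta_q$ for all $q$. Suppose that the matrices $D_q$ are nonsingular (so that $\Gamma(t)$ is defined) and that $\Gamma(t)$ is a P-matrix (all principal minors are positive). Then: (a) for every $q$ and every $x_{-q}\in\mathcal Y_{-q}$, the (nonconvex) problem of player $q$ in $\mathcal G_\pi$ has a unique optimal solution $\bar{\mathcal B}_q(x_{-q})$, and its power component is nonzero; (b) the map $\mathcal Y\ni x\mapsto\bar{\mathcal B}(x)=(\bar{\mathcal B}_q(x_{-q}))_q$ is a block-contraction: for some weights $v_q>0$ it is a contraction on $\mathcal Y$ for the norm $\|y\|=\max_q\frac1{v_q}\big\|D_q\,(|y_{q,1}|,\|y_{q,2:N+2}\|_2)\big\|_2$. It has a unique fixed point in $\mathcal Y$, and this fixed point is the unique NE of $\mathcal G_\pi$. -/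

import Mathlib

noncomputable section

namespace CognitiveRadio

/-! ### Auxiliary notions -/

/-- The Gaussian tail function `(1/√(2π)) ∫_x^∞ exp(-u²/2) du`. -/
def qFun (x : ℝ) : ℝ :=
  (1 / Real.sqrt (2 * Real.pi)) * ∫ u in Set.Ioi x, Real.exp (-u ^ 2 / 2)

/-- The inverse of the (strictly decreasing) Gaussian tail function; only its values on the
range `(0, 1)` of `qFun` are ever used. -/
def qInv : ℝ → ℝ := Function.invFun qFun

/-- Spectral norm of a real matrix (operator norm for the Euclidean norms). -/
def specNorm {m n : Type*} [Fintype m] [DecidableEq m] [Fintype n] [DecidableEq n]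
    (A : Matrix m n ℝ) : ℝ :=
  ‖LinearMap.toContinuousLinearMap (Matrix.toEuclideanLin A)‖

/-- Least (real) eigenvalue of a square matrix; it is used for symmetric matrices only. -/
def leastEig {n : Type*} [Fintype n] (A : Matrix n n ℝ) : ℝ :=
  sInf {μ : ℝ | ∃ v : n → ℝ, v ≠ 0 ∧ A.mulVec v = μ • v}

/-- A P-matrix: every principal minor is positive. -/
def IsPMatrix {n : Type*} [DecidableEq n] (A : Matrix n n ℝ) : Prop :=
  ∀ s : Finset n, s.Nonempty →
    0 < (A.submatrix (fun i : s => (i : n)) (fun i : s => (i : n))).det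

/-- The coordinates of one strategy: the normalized sensing time (left summand), then the block
made of the `N` powers and the false alarm probability (right summand). -/
abbrev Coord (N : ℕ) : Type := Unit ⊕ (Fin N ⊕ Unit)

/-- A strategy `(τ̂, p, P)` of one player, a vector with `N + 2` real coordinates. -/
abbrev Strategy (N : ℕ) : Type := Coord N → ℝ

/-- A strategy profile. -/
abbrev Profile (Q N : ℕ) : Type := Fin Q → Strategy N

/-- Normalized sensing time of a strategy. -/
def Strategy.sens {N : ℕ} (x : Strategy N) : ℝ := x (Sum.inl ())

/-- Power allocation of a strategy. -/
def Strategy.pow {N : ℕ} (x : Strategy N) (k : Fin N) : ℝ := x (Sum.inr (Sum.inl k))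

/-- False alarm probability of a strategy. -/
def Strategy.fa {N : ℕ} (x : Strategy N) : ℝ := x (Sum.inr (Sum.inr ()))

/-- Partial derivative of `F` with respect to the coordinate `i` of player `q`. -/
def partialDeriv {Q N : ℕ} (F : Profile Q N → ℝ) (q : Fin Q) (i : Coord N)
    (x : Profile Q N) : ℝ :=
  deriv (fun s : ℝ => F (Function.update x q (Function.update (x q) i s))) (x q i)

/-- The matrix of second partial derivatives `∇²_{x_q x_r} F` (rows: player `q`, columns:
player `r`). -/
def hess {Q N : ℕ} (F : Profile Q N → ℝ) (q r : Fin Q) (x : Profile Q N) :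
    Matrix (Coord N) (Coord N) ℝ :=
  Matrix.of fun i j => partialDeriv (fun y => partialDeriv F r j y) q i x

/-! ### The data of the system -/

/-- Data of a cognitive radio system with `Q` secondary users and `N` subcarriers. -/
structure System (Q N : ℕ) where
  /-- `H q r k`: channel from the transmitter of user `r` to the receiver of user `q`. -/
  H : Fin Q → Fin Q → Fin N → ℂ
  /-- Noise power spectral densities `σ²_{q,k}`. -/
  noisePSD : Fin Q → Fin N → ℝ
  /-- Parameters of the energy detector, without (`0`) and with (`1`) a primary signal. -/
  mu0 : Fin Q → Fin N → ℝ
  mu1 : Fin Q → Fin N → ℝ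
  sigma0 : Fin Q → Fin N → ℝ
  sigma1 : Fin Q → Fin N → ℝ
  /-- Sampling frequencies, frame durations, and bounds on the sensing times. -/
  f : Fin Q → ℝ
  T : Fin Q → ℝ
  tauMin : Fin Q → ℝ
  tauMax : Fin Q → ℝ
  /-- Bounds on the missed detection and on the false alarm probabilities. -/
  alpha : Fin Q → Fin N → ℝ
  beta : Fin Q → ℝ
  /-- Power budgets, spectral masks, interference weights, and interference limits. -/
  budget : Fin Q → ℝ
  pMax : Fin Q → Fin N → ℝ
  w : Fin Q → Fin N → ℝ
  locMax : Fin Q → ℝ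
  globMax : ℝ
  H_ne_zero : ∀ q k, H q q k ≠ 0
  noisePSD_pos : ∀ q k, 0 < noisePSD q k
  sigma0_pos : ∀ q k, 0 < sigma0 q k
  sigma1_pos : ∀ q k, 0 < sigma1 q k
  f_pos : ∀ q, 0 < f q
  tauMin_pos : ∀ q, 0 < tauMin q
  tauMin_lt : ∀ q, tauMin q < tauMax q
  tauMax_lt : ∀ q, tauMax q < T q
  alpha_pos : ∀ q k, 0 < alpha q k
  alpha_le : ∀ q k, alpha q k ≤ 1 / 2
  beta_pos : ∀ q, 0 < beta q
  beta_le : ∀ q, beta q ≤ 1 / 2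
  budget_pos : ∀ q, 0 < budget q
  pMax_pos : ∀ q k, 0 < pMax q k
  w_pos : ∀ q k, 0 < w q k
  locMax_pos : ∀ q, 0 < locMax q

namespace System

variable {Q N : ℕ} (S : System Q N)

/-! ### The game -/

/-- Normalized cross-channel gain `|H_{qr}(k) / H_{qq}(k)|²`. -/
def gain (q r : Fin Q) (k : Fin N) : ℝ := ‖S.H q r k / S.H q q k‖ ^ 2

/-- Normalized noise power `σ²_{q,k} / |H_{qq}(k)|²`. -/
def noise (q : Fin Q) (k : Fin N) : ℝ := S.noisePSD q k / ‖S.H q q k‖ ^ 2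

/-- Information rate of user `q` on carrier `k`. -/
def rate (q : Fin Q) (k : Fin N) (x : Profile Q N) : ℝ :=
  Real.log (1 + (x q).pow k /
    (S.noise q k + ∑ r ∈ Finset.univ.erase q, S.gain q r k * (x r).pow k))

/-- Missed detection probability: one minus the detection probability. -/
def missProb (q : Fin Q) (k : Fin N) (y : Strategy N) : ℝ :=
  1 - qFun ((S.sigma0 q k * qInv y.fa - (S.mu1 q k - S.mu0 q k) * y.sens) / S.sigma1 q k)

/-- Aggregate opportunistic throughput of user `q`. -/
def throughput (q : Fin Q) (x : Profile Q N) : ℝ :=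
  (1 - (x q).sens ^ 2 / (S.f q * S.T q)) * ∑ k, (1 - (x q).fa) * S.rate q k x

/-- The payoff `θ_q`: logarithm of the throughput minus the equi-sensing penalty. -/
def theta (c : ℝ) (q : Fin Q) (x : Profile Q N) : ℝ :=
  Real.log (S.throughput q x) -
    c / 2 * ((x q).sens / Real.sqrt (S.f q) -
      1 / (Q : ℝ) * ∑ r, (x r).sens / Real.sqrt (S.f r)) ^ 2

/-- Local interference violation `I_q`. -/
def locInt (q : Fin Q) (y : Strategy N) : ℝ :=
  ∑ k, S.missProb q k y * S.w q k * y.pow k - S.locMax q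

/-- Global interference violation `I`. -/
def globInt (x : Profile Q N) : ℝ :=
  ∑ k, ∑ q, S.missProb q k (x q) * S.w q k * (x q).pow k - S.globMax

/-- Powers allowed by the budget and the spectral mask. -/
def powerSet (q : Fin Q) : Set (Fin N → ℝ) :=
  {p | ∑ k, p k ≤ S.budget q ∧ ∀ k, 0 ≤ p k ∧ p k ≤ S.pMax q k}

/-- The bound `α̂_{q,k}` in the detection constraint. -/
def alphaHat (q : Fin Q) (k : Fin N) : ℝ := qInv (1 - S.alpha q k)

/-- The convex part `Y_q` of the strategy set. A false alarm probability is positive, as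
the inverse of the tail function requires. -/
def convSet (q : Fin Q) : Set (Strategy N) :=
  {y | 0 < y.fa ∧ y.fa ≤ S.beta q ∧
    (∀ k, S.sigma0 q k / S.sigma1 q k * qInv y.fa -
      y.sens * ((S.mu1 q k - S.mu0 q k) / S.sigma1 q k) ≤ S.alphaHat q k) ∧
    y.pow ∈ S.powerSet q ∧
    Real.sqrt (S.tauMin q * S.f q) ≤ y.sens ∧ y.sens ≤ Real.sqrt (S.tauMax q * S.f q)}

/-- The product `Y` of the convex parts. -/
def convProd : Set (Profile Q N) := {x | ∀ q, x q ∈ S.convSet q}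

/-- The strategy set `X_q`. -/
def stratSet (q : Fin Q) : Set (Strategy N) := {y | y ∈ S.convSet q ∧ S.locInt q y ≤ 0}

/-- Objective `θ_q - π I` of player `q` at the price `π`, with the convention `log 0 = -∞`. -/
def objective (c price : ℝ) (q : Fin Q) (x : Profile Q N) : EReal :=
  if 0 < S.throughput q x then ((S.theta c q x - price * S.globInt x : ℝ) : EReal) else ⊥

/-- `y` is an optimal solution of the problem of player `q`, the other strategies being those
of `x` (the component `x q` plays no role). -/
def IsOptimal (c price : ℝ) (q : Fin Q) (x : Profile Q N) (y : Strategy N) : Prop :=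
  y ∈ S.stratSet q ∧ ∀ z ∈ S.stratSet q,
    S.objective c price q (Function.update x q z) ≤ S.objective c price q (Function.update x q y)

/-- Nash equilibrium of the game with a fixed exogenous price. -/
def IsNash (c price : ℝ) (x : Profile Q N) : Prop := ∀ q, S.IsOptimal c price q x (x q)

/-! ### The matrix `Γ(t)` -/

/-- Lagrangian of player `q`; `m` is the multiplier of the local interference constraint. -/
def lagrangian (c price m : ℝ) (q : Fin Q) (x : Profile Q N) : ℝ :=
  -S.theta c q x + m * S.locInt q (x q) + price * S.globInt x

/-- The upper bound `λ^max` on the multipliers. -/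
def multMax : ℝ :=
  ∑ q, (1 / ⨅ r, min (S.locMax r) (⨅ k, S.pMax r k)) /
    ((⨅ k, 1 / S.pMax q k * Real.log (1 + S.pMax q k /
        (S.noise q k + ∑ r ∈ Finset.univ.erase q, S.gain q r k * S.pMax r k))) *
      ⨅ k, S.noise q k)

/-- A reference power allocation: admissible, nonzero, and compatible with the local
interference limit at every admissible pair of sensing time and false alarm probability. -/
def IsRefPower (q : Fin Q) (p : Fin N → ℝ) : Prop :=
  p ∈ S.powerSet q ∧ p ≠ 0 ∧ ∑ k, S.w q k * p k ≤ 2 * S.locMax q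

/-- The reference false alarm probability. -/
def faRef (q : Fin Q) : ℝ :=
  ⨆ k, qFun ((S.sigma1 q k * S.alphaHat q k +
    (S.mu1 q k - S.mu0 q k) * Real.sqrt (S.f q * S.tauMin q)) / S.sigma0 q k)

/-- The reference level `η_q(t)`: a lower bound for the optimal values of player `q`. -/
def etaRef (t : ℝ) (q : Fin Q) (p : Fin N → ℝ) : ℝ :=
  Real.log (1 - S.tauMax q / S.T q) + Real.log (1 - S.faRef q) +
    Real.log (∑ k, Real.log (1 + p k /
      (S.noise q k + ∑ r ∈ Finset.univ.erase q, S.gain q r k * S.pMax r k))) -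
    t / 2 * ∑ k, S.w q k * p k

/-- The restriction of `Y_q` to total powers above the level given by `η_q(t)`. -/
def convSetLow (t : ℝ) (pRef : Fin Q → Fin N → ℝ) (q : Fin Q) : Set (Strategy N) :=
  {y | y ∈ S.convSet q ∧
    (⨅ k, S.noise q k) * Real.exp (S.etaRef t q (pRef q)) ≤ ∑ k, y.pow k}

/-- Profiles with `x_q` in the restricted set and `x_r` in `Y_r` for all `r ≠ q`. -/
def profilesLow (t : ℝ) (pRef : Fin Q → Fin N → ℝ) (q : Fin Q) : Set (Profile Q N) :=
  {x | x q ∈ S.convSetLow t pRef q ∧ ∀ r, r ≠ q → x r ∈ S.convSet r}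

/-- The `2 × 2` matrix `B_q`, built from the Hessian of the Lagrangian in the variables of
player `q`. -/
def Bmat (price m : ℝ) (q : Fin Q) (x : Profile Q N) : Matrix (Fin 2) (Fin 2) ℝ :=
  let L := hess (S.lagrangian 0 price m q) q q x
  !![L (Sum.inl ()) (Sum.inl ()), -specNorm L.toBlocks₁₂;
     -specNorm L.toBlocks₂₁, leastEig L.toBlocks₂₂]

/-- The number `ρ_q(t)`: positive part of the minimum over profiles, multipliers and prices of
the least eigenvalue of `B_q`. -/
def rho (t : ℝ) (pRef : Fin Q → Fin N → ℝ) (q : Fin Q) : ℝ :=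
  max 0 (sInf {e : ℝ | ∃ x ∈ S.profilesLow t pRef q, ∃ m ∈ Set.Icc 0 S.multMax,
    ∃ price ∈ Set.Icc 0 t, e = leastEig (S.Bmat price m q x)})

/-- The diagonal matrix `D_q(t, c)`. -/
def Dmat (c t : ℝ) (pRef : Fin Q → Fin N → ℝ) (q : Fin Q) : Matrix (Fin 2) (Fin 2) ℝ :=
  Matrix.diagonal
    ![Real.sqrt (S.rho t pRef q + c * ((1 - 1 / (Q : ℝ)) / Real.sqrt (S.f q)) ^ 2),
      Real.sqrt (S.rho t pRef q)]

/-- The diagonal matrix `E_{qr}(x)`. -/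
def Emat (c : ℝ) (q r : Fin Q) (x : Profile Q N) : Matrix (Fin 2) (Fin 2) ℝ :=
  let A := hess (S.theta c q) q r x
  Matrix.diagonal
    ![|A (Sum.inl ()) (Sum.inl ())|,
      specNorm (A.submatrix (fun k : Fin N => Sum.inr (Sum.inl k))
        (fun k : Fin N => Sum.inr (Sum.inl k)))]

/-- The coefficients `β_{qr}(t, c)`. -/
def betaCoef (c t : ℝ) (pRef : Fin Q → Fin N → ℝ) (q r : Fin Q) : ℝ :=
  sSup ((fun x => specNorm ((S.Dmat c t pRef q)⁻¹ * S.Emat c q r x * (S.Dmat c t pRef r)⁻¹)) ''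
    S.profilesLow t pRef q)

/-- The matrix `Γ(t)`. -/
def Gamma (c t : ℝ) (pRef : Fin Q → Fin N → ℝ) : Matrix (Fin Q) (Fin Q) ℝ :=
  Matrix.of fun q r => if r = q then 1 else -S.betaCoef c t pRef q r

/-- The weighted block-maximum norm on profiles. The norm of the block `y` of player `q` is the
Euclidean norm of `D_q(t, c) (|y₁|, ‖y_{2:N+2}‖₂)`. -/
def blockNorm (c t : ℝ) (pRef : Fin Q → Fin N → ℝ) (v : Fin Q → ℝ) (y : Profile Q N) : ℝ :=
  ⨆ q, ‖WithLp.toLp 2 ((S.Dmat c t pRef q).mulVec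
    ![|y q (Sum.inl ())|, ‖WithLp.toLp 2 (fun j : Fin N ⊕ Unit => y q (Sum.inr j))‖])‖ / v q

end System

end CognitiveRadio

end

/-! The problem of a player is nonconvex, because of the products of miss probability and power, but
its Lagrangian is strongly convex wherever that matters.

First, every best response lies in the convex set `convSetLow` (`IsOptimal.mem_convSetLow`). Miss
probabilities are at most 1/2, so the reference powers are feasible with the sensing time and false
alarm probability of the best response; comparing the two payoffs bounds its total power below.
There the payoff is smooth. Second, a best response has a multiplier in `[0, multMax]`
(`IsOptimal.exists_multiplier`). Shrinking all powers toward zero strictly relaxes an active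
constraint, which yields the multiplier; the cost grows at rate at most 1 in that direction, so the
multiplier is at most `1 / locMax`. Third, by the definition of `rho`, the Lagrangian without the
penalty has curvature at least `rho` on `convSetLow`, for all these multipliers and prices in `[0,
t]`; the penalty, a square of an affine function, adds exactly its own curvature. Hence the cost
grows quadratically, in the norm given by `D_q`, from a best response to any feasible point of
`convSetLow` (`IsOptimal.cost_add_sq_le`). Uniqueness follows.

For the contraction, two best responses to different opponents are each tested against the other,
and the two growth inequalities are added. The interference is a sum over players, so it cancels,
and the squared distance is bounded by a mixed second difference of `theta`. That difference is a
second derivative between own and foreign directions, which only couples sensing times with sensing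
times and powers with powers; the coefficients `betaCoef` bound it (`IsOptimal.stratNorm_sub_le`). A
P-matrix with nonpositive off-diagonal entries maps some positive vector `v` to a positive vector,
so the best response contracts the maximum norm with weights `v`. Compactness of `Y` gives the fixed
point, and equilibria are exactly the fixed points in `Y`. -/

namespace CognitiveRadio

open Set Filter Topology MeasureTheory

/-! ### The Gaussian tail function -/

/-- The Gaussian density. -/
noncomputable def gaussDens (x : ℝ) : ℝ := 1 / √(2 * Real.pi) * Real.exp (-x ^ 2 / 2)

lemma gaussDens_pos (x : ℝ) : 0 < gaussDens x := by
  unfold gaussDens; positivity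

lemma contDiff_gaussDens {n : WithTop ℕ∞} : ContDiff ℝ n gaussDens := by
  unfold gaussDens
  fun_prop

lemma integrable_gaussDens : Integrable gaussDens := by
  have h := (integrable_exp_neg_mul_sq (b := 1 / 2) (by norm_num)).const_mul (1 / √(2 * Real.pi))
  refine h.congr (ae_of_all _ fun x => ?_)
  simp only [gaussDens]
  congr 2
  ring

lemma integral_gaussDens : ∫ u, gaussDens u = 1 := by
  have h := integral_gaussian (1 / 2)
  have h2 : ∀ u, gaussDens u = 1 / √(2 * Real.pi) * Real.exp (-(1 / 2) * u ^ 2) := by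
    intro u
    simp only [gaussDens]
    congr 2
    ring
  simp_rw [h2]
  rw [integral_const_mul, h, show Real.pi / (1 / 2) = 2 * Real.pi by ring]
  have : √(2 * Real.pi) ≠ 0 := by positivity
  field_simp

lemma qFun_eq (x : ℝ) : qFun x = ∫ u in Ioi x, gaussDens u := by
  unfold qFun gaussDens
  rw [integral_const_mul]

lemma qFun_sub (a b : ℝ) : qFun a - qFun b = ∫ u in a..b, gaussDens u := by
  rw [qFun_eq, qFun_eq, ← intervalIntegral.integral_interval_add_Ioi
    integrable_gaussDens.integrableOn integrable_gaussDens.integrableOn (a := a) (b := b)]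
  ring

lemma hasDerivAt_qFun (x : ℝ) : HasDerivAt qFun (-gaussDens x) x := by
  have h : qFun = fun x => qFun 0 - ∫ u in (0 : ℝ)..x, gaussDens u := by
    funext x
    rw [← qFun_sub]
    ring
  rw [h]
  refine HasDerivAt.const_sub _ ?_
  have hc : Continuous gaussDens := (contDiff_gaussDens (n := 0)).continuous
  exact intervalIntegral.integral_hasDerivAt_right (hc.intervalIntegrable _ _)
    hc.stronglyMeasurable.stronglyMeasurableAtFilter hc.continuousAt

lemma deriv_qFun : deriv qFun = fun x => -gaussDens x :=
  funext fun x => (hasDerivAt_qFun x).deriv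

lemma differentiable_qFun : Differentiable ℝ qFun :=
  fun x => (hasDerivAt_qFun x).differentiableAt

lemma continuous_qFun : Continuous qFun := differentiable_qFun.continuous

lemma contDiff_qFun : ContDiff ℝ 2 qFun := by
  rw [show (2 : WithTop ℕ∞) = 1 + 1 by norm_num, contDiff_succ_iff_deriv]
  refine ⟨differentiable_qFun, by simp, ?_⟩
  rw [deriv_qFun]
  exact contDiff_gaussDens.neg

lemma strictAnti_qFun : StrictAnti qFun :=
  strictAnti_of_deriv_neg fun x => by rw [deriv_qFun]; exact neg_neg_of_pos (gaussDens_pos x)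

lemma tendsto_qFun_atTop : Tendsto qFun atTop (𝓝 0) := by
  have h := intervalIntegral_tendsto_integral_Ioi (μ := volume) (f := gaussDens) 0
    integrable_gaussDens.integrableOn tendsto_id
  have h2 : Tendsto (fun x => qFun 0 - (qFun 0 - qFun x)) atTop (𝓝 (qFun 0 - qFun 0)) := by
    refine Tendsto.const_sub _ ?_
    simp_rw [qFun_sub]
    rw [qFun_eq]
    exact h
  simpa using h2

lemma tendsto_qFun_atBot : Tendsto qFun atBot (𝓝 1) := by
  have h := intervalIntegral_tendsto_integral (μ := volume) integrable_gaussDens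
    (tendsto_id (α := ℝ) (x := atBot)) (tendsto_neg_atBot_atTop)
  rw [integral_gaussDens] at h
  have h3 : Tendsto (fun x : ℝ => qFun (-x)) atBot (𝓝 0) :=
    tendsto_qFun_atTop.comp tendsto_neg_atBot_atTop
  have h4 := h.add h3
  refine (h4.congr fun x => ?_).trans (by simp)
  simp only [id]
  rw [← qFun_sub]
  ring

lemma qFun_pos (x : ℝ) : 0 < qFun x := by
  have h : 0 ≤ qFun (x + 1) :=
    strictAnti_qFun.antitone.le_of_tendsto tendsto_qFun_atTop _
  exact h.trans_lt (strictAnti_qFun (by linarith))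

lemma qFun_lt_one (x : ℝ) : qFun x < 1 := by
  have h : qFun (x - 1) ≤ 1 :=
    strictAnti_qFun.antitone.ge_of_tendsto tendsto_qFun_atBot _
  exact (strictAnti_qFun (by linarith)).trans_le h

/-- The density is even, so the sum of the two tails has zero derivative; its limit at infinity is
1. This serves to get the value 1/2 at 0. -/
lemma qFun_neg (x : ℝ) : qFun (-x) = 1 - qFun x := by
  have hd : ∀ y, HasDerivAt (fun y => qFun (-y) + qFun y) 0 y := by
    intro y
    have h1 : HasDerivAt (fun y => qFun (-y)) (-gaussDens (-y) * (-1)) y :=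
      (hasDerivAt_qFun (-y)).comp y (hasDerivAt_neg y)
    refine (h1.add (hasDerivAt_qFun y)).congr_deriv ?_
    simp [gaussDens]
  have hc : ∀ y, qFun (-y) + qFun y = qFun (-x) + qFun x := fun y =>
    is_const_of_deriv_eq_zero (fun z => (hd z).differentiableAt) (fun z => (hd z).deriv) y x
  have hl : Tendsto (fun y : ℝ => qFun (-y) + qFun y) atTop (𝓝 (1 + 0)) :=
    (tendsto_qFun_atBot.comp tendsto_neg_atTop_atBot).add tendsto_qFun_atTop
  have := tendsto_nhds_unique (hl.congr hc) tendsto_const_nhds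
  linarith

lemma qFun_zero : qFun 0 = 1 / 2 := by
  have := qFun_neg 0
  rw [neg_zero] at this
  linarith

/-- The density decreases on the half-line. Convexity fails on the negative side, which is why the
bound `beta ≤ 1/2` matters in `convex_convSet`. -/
lemma convexOn_qFun : ConvexOn ℝ (Ici 0) qFun := by
  refine MonotoneOn.convexOn_of_deriv (convex_Ici 0) continuous_qFun.continuousOn
    differentiable_qFun.differentiableOn ?_
  rw [deriv_qFun, interior_Ici]
  intro a ha b hb hab
  simp only [neg_le_neg_iff, gaussDens]
  have : a ^ 2 ≤ b ^ 2 := pow_le_pow_left₀ (le_of_lt ha) hab 2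
  gcongr

lemma exists_qFun_eq {y : ℝ} (h0 : 0 < y) (h1 : y < 1) : ∃ x, qFun x = y := by
  obtain ⟨a, ha⟩ := (tendsto_qFun_atBot.eventually (lt_mem_nhds h1)).exists
  obtain ⟨b, hb⟩ := (tendsto_qFun_atTop.eventually (gt_mem_nhds h0)).exists
  exact mem_range_of_exists_le_of_exists_ge continuous_qFun ⟨b, hb.le⟩ ⟨a, ha.le⟩

lemma qInv_qFun (x : ℝ) : qInv (qFun x) = x :=
  Function.leftInverse_invFun strictAnti_qFun.injective x

lemma qFun_qInv {y : ℝ} (h0 : 0 < y) (h1 : y < 1) : qFun (qInv y) = y :=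
  Function.invFun_eq (exists_qFun_eq h0 h1)

lemma qInv_le_iff {y c : ℝ} (h0 : 0 < y) (h1 : y < 1) : qInv y ≤ c ↔ qFun c ≤ y := by
  conv_rhs => rw [← qFun_qInv h0 h1]
  exact strictAnti_qFun.le_iff_ge.symm

/-- Inverse function theorem: `qInv` is a left inverse of `qFun` everywhere, hence agrees near the
point with the smooth local inverse. -/
lemma contDiffAt_qInv {y : ℝ} (h0 : 0 < y) (h1 : y < 1) : ContDiffAt ℝ 2 qInv y := by
  obtain ⟨x, rfl⟩ := exists_qFun_eq h0 h1
  have hne : -gaussDens x ≠ 0 := (neg_neg_of_pos (gaussDens_pos x)).ne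
  have hd := (hasDerivAt_qFun x).hasFDerivAt_equiv hne
  have hc : ContDiffAt ℝ 2 qFun x := contDiff_qFun.contDiffAt
  refine (hc.to_localInverse hd (by norm_num)).congr_of_eventuallyEq ?_
  exact (hc.hasStrictFDerivAt' hd (by norm_num)).localInverse_unique
    (Eventually.of_forall qInv_qFun)

end CognitiveRadio

namespace CognitiveRadio

open Set Filter Topology

/-! ### Second-order calculus -/

section Calculus

variable {E : Type*} [NormedAddCommGroup E] [NormedSpace ℝ E] {F : E → ℝ}

lemma hasDerivAt_line {x d : E} {s : ℝ} (h : DifferentiableAt ℝ F (x + s • d)) :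
    HasDerivAt (fun u : ℝ => F (x + u • d)) (fderiv ℝ F (x + s • d) d) s := by
  have h1 : HasDerivAt (fun u : ℝ => x + u • d) d s := by
    simpa using ((hasDerivAt_id s).smul_const d).const_add x
  exact h.hasFDerivAt.comp_hasDerivAt s h1

lemma differentiableAt_fderiv {x : E} (h : ContDiffAt ℝ 2 F x) :
    DifferentiableAt ℝ (fderiv ℝ F) x :=
  (h.fderiv_right (m := 1) (by norm_num)).differentiableAt (by norm_num)

lemma hasFDerivAt_fderiv_apply {x : E} (h : ContDiffAt ℝ 2 F x) (d : E) :
    HasFDerivAt (fun y => fderiv ℝ F y d) ((fderiv ℝ (fderiv ℝ F) x).flip d) x := by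
  simpa using (differentiableAt_fderiv h).hasFDerivAt.clm_apply (hasFDerivAt_const d x)

lemma hasDerivAt_fderiv_line {x d a : E} {s : ℝ} (h : ContDiffAt ℝ 2 F (x + s • d)) :
    HasDerivAt (fun u : ℝ => fderiv ℝ F (x + u • d) a)
      (fderiv ℝ (fderiv ℝ F) (x + s • d) d a) s := by
  have h1 := hasFDerivAt_fderiv_apply h a
  have h2 := hasDerivAt_line (F := fun y => fderiv ℝ F y a) (d := d) h1.differentiableAt
  rw [h1.fderiv] at h2
  exact h2

/-- A lower bound for the second derivative along a segment gives a quadratic lower bound. -/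
lemma quadratic_lower_bound {x d : E} {m : ℝ}
    (hF : ∀ s ∈ Icc (0 : ℝ) 1, ContDiffAt ℝ 2 F (x + s • d))
    (hm : ∀ s ∈ Icc (0 : ℝ) 1, m ≤ fderiv ℝ (fderiv ℝ F) (x + s • d) d d) :
    F x + fderiv ℝ F x d + m / 2 ≤ F (x + d) := by
  -- Taylor's bound by two monotonicity arguments: `φ'` is the first-order remainder of the slope,
  -- `φ` that of the function, and both are nondecreasing on `[0, 1]`.
  set φ' : ℝ → ℝ := fun s => fderiv ℝ F (x + s • d) d - fderiv ℝ F x d - m * s with hφ'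
  have hd' : ∀ s ∈ Icc (0 : ℝ) 1, HasDerivAt φ'
      (fderiv ℝ (fderiv ℝ F) (x + s • d) d d - m) s := by
    intro s hs
    have h1 := ((hasDerivAt_fderiv_line (a := d) (hF s hs)).sub_const (fderiv ℝ F x d)).sub
      ((hasDerivAt_id s).const_mul m)
    exact h1.congr_deriv (by simp)
  have hmono' : MonotoneOn φ' (Icc 0 1) := by
    refine monotoneOn_of_deriv_nonneg (convex_Icc 0 1)
      (fun s hs => (hd' s hs).continuousAt.continuousWithinAt)
      (fun s hs => (hd' s (interior_subset hs)).differentiableAt.differentiableWithinAt)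
      fun s hs => ?_
    rw [(hd' s (interior_subset hs)).deriv]
    linarith [hm s (interior_subset hs)]
  have hpos : ∀ s ∈ Icc (0 : ℝ) 1, 0 ≤ φ' s := by
    intro s hs
    have h0 : φ' 0 = 0 := by simp [hφ']
    rw [← h0]
    exact hmono' (by simp) hs hs.1
  set φ : ℝ → ℝ := fun s => F (x + s • d) - fderiv ℝ F x d * s - m / 2 * s ^ 2 with hφ
  have hd : ∀ s ∈ Icc (0 : ℝ) 1, HasDerivAt φ (φ' s) s := by
    intro s hs
    have h1 := ((hasDerivAt_line (d := d) ((hF s hs).differentiableAt (by norm_num))).sub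
      ((hasDerivAt_id s).const_mul (fderiv ℝ F x d))).sub
      (((hasDerivAt_id s).pow 2).const_mul (m / 2))
    refine h1.congr_deriv ?_
    simp [hφ']
    ring
  have hmono : MonotoneOn φ (Icc 0 1) := by
    refine monotoneOn_of_deriv_nonneg (convex_Icc 0 1)
      (fun s hs => (hd s hs).continuousAt.continuousWithinAt)
      (fun s hs => (hd s (interior_subset hs)).differentiableAt.differentiableWithinAt)
      fun s hs => ?_
    rw [(hd s (interior_subset hs)).deriv]
    exact hpos s (interior_subset hs)
  have := hmono (a := 0) (b := 1) (by simp) (by simp) zero_le_one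
  simp [hφ] at this
  linarith

/-- Mean value theorem for mixed second differences. -/
lemma exists_mixed_difference_eq {x a b : E}
    (hF : ∀ u ∈ Icc (0 : ℝ) 1, ∀ s ∈ Icc (0 : ℝ) 1, ContDiffAt ℝ 2 F (x + u • a + s • b)) :
    ∃ u ∈ Icc (0 : ℝ) 1, ∃ s ∈ Icc (0 : ℝ) 1,
      F (x + a + b) - F (x + a) - F (x + b) + F x =
        fderiv ℝ (fderiv ℝ F) (x + u • a + s • b) a b := by
  have h1 : ∀ s ∈ Icc (0 : ℝ) 1,
      HasDerivAt (fun s : ℝ => F (x + a + s • b) - F (x + s • b))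
        (fderiv ℝ F (x + a + s • b) b - fderiv ℝ F (x + s • b) b) s := by
    intro s hs
    refine (hasDerivAt_line ?_).sub (hasDerivAt_line ?_)
    · have := hF 1 (by simp) s hs
      rw [one_smul] at this
      exact this.differentiableAt (by norm_num)
    · have := hF 0 (by simp) s hs
      rw [zero_smul, add_zero] at this
      exact this.differentiableAt (by norm_num)
  -- The mean value theorem is used first in `s`, for the increment in direction `a`, then in `u`,
  -- for the derivative in direction `b`.
  obtain ⟨s, hs, hs'⟩ := exists_hasDerivAt_eq_slope _ _ (zero_lt_one (α := ℝ))
    (fun s hs => (h1 s hs).continuousAt.continuousWithinAt)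
    (fun s hs => h1 s (Ioo_subset_Icc_self hs))
  have hsI := Ioo_subset_Icc_self hs
  have h2 : ∀ u ∈ Icc (0 : ℝ) 1,
      HasDerivAt (fun u : ℝ => fderiv ℝ F (x + s • b + u • a) b)
        (fderiv ℝ (fderiv ℝ F) (x + s • b + u • a) a b) u := by
    intro u hu
    refine hasDerivAt_fderiv_line ?_
    rw [add_right_comm]
    exact hF u hu s hsI
  obtain ⟨u, hu, hu'⟩ := exists_hasDerivAt_eq_slope _ _ (zero_lt_one (α := ℝ))
    (fun u hu => (h2 u hu).continuousAt.continuousWithinAt)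
    (fun u hu => h2 u (Ioo_subset_Icc_self hu))
  refine ⟨u, Ioo_subset_Icc_self hu, s, hsI, ?_⟩
  rw [add_right_comm x (u • a), hu']
  simp only [one_smul, zero_smul, add_zero, sub_zero, div_one] at hs' ⊢
  rw [add_right_comm x (s • b), hs']
  ring

end Calculus

/-! ### Partial derivatives of functions of a profile -/

section Partial

variable {Q N : ℕ} {F G : Profile Q N → ℝ} {x : Profile Q N}

/-- The unit vector of the coordinate `i` of player `q`. -/
noncomputable def unitVec (q : Fin Q) (i : Coord N) : Profile Q N := Pi.single q (Pi.single i 1)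

lemma update_update_eq (x : Profile Q N) (q : Fin Q) (i : Coord N) (s : ℝ) :
    Function.update x q (Function.update (x q) i s) = x + (s - x q i) • unitVec q i := by
  funext r j
  by_cases hr : r = q
  · subst hr
    by_cases hj : j = i
    · subst hj; simp [unitVec]
    · simp [unitVec, hj]
  · simp [unitVec, hr]

lemma partialDeriv_eq (h : DifferentiableAt ℝ F x) (q : Fin Q) (i : Coord N) :
    partialDeriv F q i x = fderiv ℝ F x (unitVec q i) := by
  unfold partialDeriv
  simp_rw [update_update_eq]
  have h1 : HasDerivAt (fun u : ℝ => F (x + u • unitVec q i))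
      (fderiv ℝ F x (unitVec q i)) (x q i - x q i) := by
    have := hasDerivAt_line (F := F) (x := x) (d := unitVec q i) (s := x q i - x q i)
      (by simpa using h)
    simpa using this
  have h2 := HasDerivAt.comp_sub_const (x q i) (x q i) h1
  exact h2.deriv

/-- `hess` iterates one-variable derivatives, so the inner one must be known on a whole
neighbourhood; being C² at a point is an open condition and supplies it. -/
lemma hess_apply (h : ContDiffAt ℝ 2 F x) (q r : Fin Q) (i j : Coord N) :
    hess F q r x i j = fderiv ℝ (fderiv ℝ F) x (unitVec q i) (unitVec r j) := by
  have h1 : (fun y => partialDeriv F r j y) =ᶠ[𝓝 x] fun y => fderiv ℝ F y (unitVec r j) := by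
    filter_upwards [h.eventually (by simp)] with y hy
    exact partialDeriv_eq (hy.differentiableAt (by norm_num)) r j
  have h2 := hasFDerivAt_fderiv_apply h (unitVec r j)
  have h3 := h2.congr_of_eventuallyEq h1
  simp only [hess, Matrix.of_apply]
  rw [partialDeriv_eq h3.differentiableAt, h3.fderiv]
  rfl

lemma profile_eq_sum (q : Fin Q) (d : Strategy N) :
    (Pi.single q d : Profile Q N) = ∑ i, d i • unitVec q i := by
  funext r j
  by_cases hr : r = q
  · subst hr
    simp [unitVec, Finset.sum_apply, Pi.single_apply]
  · simp [unitVec, Finset.sum_apply, hr]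

lemma fderiv_fderiv_single (h : ContDiffAt ℝ 2 F x) (q r : Fin Q) (a b : Strategy N) :
    fderiv ℝ (fderiv ℝ F) x (Pi.single q a) (Pi.single r b) =
      a ⬝ᵥ (hess F q r x).mulVec b := by
  simp only [profile_eq_sum, map_sum, map_smul, sum_apply,
    smul_apply, dotProduct, Matrix.mulVec, hess_apply h, smul_eq_mul,
    Finset.mul_sum]
  rw [Finset.sum_comm]
  exact Finset.sum_congr rfl fun i _ => Finset.sum_congr rfl fun j _ => by ring

lemma hess_transpose (h : ContDiffAt ℝ 2 F x) (q r : Fin Q) :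
    (hess F q r x).transpose = hess F r q x := by
  ext i j
  rw [Matrix.transpose_apply, hess_apply h, hess_apply h]
  exact h.isSymmSndFDerivAt (by simp) _ _

lemma continuousAt_hess (h : ContDiffAt ℝ 2 F x) (q r : Fin Q) :
    ContinuousAt (fun y => hess F q r y) x := by
  have hc : ContinuousAt (fderiv ℝ (fderiv ℝ F)) x :=
    ((h.fderiv_right (m := 1) (by norm_num)).fderiv_right (m := 0) (by norm_num)).continuousAt
  refine continuousAt_pi.2 fun i => continuousAt_pi.2 fun j => ?_
  have h1 : (fun y => hess F q r y i j) =ᶠ[𝓝 x]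
      fun y => fderiv ℝ (fderiv ℝ F) y (unitVec q i) (unitVec r j) := by
    filter_upwards [h.eventually (by simp)] with y hy
    exact hess_apply hy q r i j
  refine ContinuousAt.congr ?_ h1.symm
  exact (hc.clm_apply continuousAt_const).clm_apply continuousAt_const

lemma partialDeriv_eq_zero {q : Fin Q} {i : Coord N}
    (h : ∀ (x : Profile Q N) (s : ℝ),
      F (Function.update x q (Function.update (x q) i s)) = F x) (x : Profile Q N) :
    partialDeriv F q i x = 0 := by
  unfold partialDeriv
  simp_rw [h]
  simp

lemma hess_eq_zero_right {q r : Fin Q} {i j : Coord N}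
    (h : ∀ (x : Profile Q N) (s : ℝ),
      F (Function.update x r (Function.update (x r) j s)) = F x) (x : Profile Q N) :
    hess F q r x i j = 0 := by
  simp only [hess, Matrix.of_apply]
  refine partialDeriv_eq_zero (fun y s => ?_) x
  rw [partialDeriv_eq_zero h, partialDeriv_eq_zero h]

/-- Here the unused coordinate belongs to the outer derivative, so symmetry of second derivatives,
hence smoothness, is needed to exchange the two. -/
lemma hess_eq_zero_left {q r : Fin Q} {i j : Coord N} (hF : ContDiffAt ℝ 2 F x)
    (h : ∀ (x : Profile Q N) (s : ℝ),
      F (Function.update x q (Function.update (x q) i s)) = F x) :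
    hess F q r x i j = 0 := by
  rw [← hess_transpose hF, Matrix.transpose_apply]
  exact hess_eq_zero_right h x

lemma hess_congr (h : F =ᶠ[𝓝 x] G) (hF : ContDiffAt ℝ 2 F x) (q r : Fin Q) :
    hess F q r x = hess G q r x := by
  ext i j
  rw [hess_apply hF, hess_apply (hF.congr_of_eventuallyEq h.symm), h.fderiv.fderiv_eq]

lemma hess_add (hF : ContDiffAt ℝ 2 F x) (hG : ContDiffAt ℝ 2 G x) (q r : Fin Q) :
    hess (fun y => F y + G y) q r x = hess F q r x + hess G q r x := by
  ext i j
  rw [Matrix.add_apply, hess_apply hF, hess_apply hG, hess_apply (hF.add hG)]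
  have h1 : fderiv ℝ (fun y => F y + G y) =ᶠ[𝓝 x] fun y => fderiv ℝ F y + fderiv ℝ G y := by
    filter_upwards [hF.eventually (by simp), hG.eventually (by simp)] with y h1 h2
    exact fderiv_fun_add (h1.differentiableAt (by norm_num)) (h2.differentiableAt (by norm_num))
  rw [h1.fderiv_eq, fderiv_fun_add (differentiableAt_fderiv hF) (differentiableAt_fderiv hG)]
  rfl

end Partial

end CognitiveRadio

namespace CognitiveRadio

open Set Filter Topology Matrix

/-! ### Linear algebra -/

section LinearAlgebra

variable {m n : Type*} [Fintype m] [DecidableEq m] [Fintype n] [DecidableEq n]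

section L2
open scoped Matrix.Norms.L2Operator

lemma specNorm_eq_norm (A : Matrix m n ℝ) : specNorm A = ‖A‖ := rfl

lemma specNorm_transpose (A : Matrix m n ℝ) : specNorm Aᵀ = specNorm A := by
  rw [specNorm_eq_norm, specNorm_eq_norm, ← Matrix.conjTranspose_eq_transpose_of_trivial,
    Matrix.l2_opNorm_conjTranspose]

end L2

lemma specNorm_nonneg (A : Matrix m n ℝ) : 0 ≤ specNorm A := norm_nonneg _

lemma continuous_specNorm : Continuous (specNorm : Matrix m n ℝ → ℝ) := by
  unfold specNorm
  have : Continuous fun A : Matrix m n ℝ =>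
      LinearMap.toContinuousLinearMap (Matrix.toEuclideanLin A) :=
    ((LinearMap.toContinuousLinearMap (𝕜 := ℝ)).toLinearMap ∘ₗ
      (Matrix.toEuclideanLin (𝕜 := ℝ) (m := m) (n := n)).toLinearMap).continuous_of_finiteDimensional
  exact this.norm

lemma abs_dotProduct_le {n : Type*} [Fintype n] (u v : n → ℝ) :
    |u ⬝ᵥ v| ≤ ‖WithLp.toLp 2 u‖ * ‖WithLp.toLp 2 v‖ := by
  have h := abs_real_inner_le_norm (WithLp.toLp 2 v) (WithLp.toLp 2 u)
  rw [EuclideanSpace.inner_toLp_toLp] at h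
  simpa [mul_comm] using h

lemma abs_dotProduct_mulVec_le (A : Matrix m n ℝ) (u : m → ℝ) (v : n → ℝ) :
    |u ⬝ᵥ A.mulVec v| ≤ ‖WithLp.toLp 2 u‖ * (specNorm A * ‖WithLp.toLp 2 v‖) := by
  refine (abs_dotProduct_le _ _).trans ?_
  gcongr
  exact (LinearMap.toContinuousLinearMap (Matrix.toEuclideanLin A)).le_opNorm (WithLp.toLp 2 v)

lemma dotProduct_self_eq_norm_sq {n : Type*} [Fintype n] (v : n → ℝ) :
    v ⬝ᵥ v = ‖WithLp.toLp 2 v‖ ^ 2 := by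
  rw [EuclideanSpace.real_norm_sq_eq, dotProduct]
  exact Finset.sum_congr rfl fun i _ => by simp [sq]

lemma leastEig_mul_le {A : Matrix n n ℝ} (hA : Aᵀ = A) (v : n → ℝ) :
    leastEig A * (v ⬝ᵥ v) ≤ v ⬝ᵥ A.mulVec v := by
  have hH : A.IsHermitian := by
    rw [Matrix.IsHermitian, Matrix.conjTranspose_eq_transpose_of_trivial, hA]
  -- `leastEig` is an infimum of reals, thus a lower bound only once the set is bounded below; the
  -- spectrum is finite.
  have hbdd : BddBelow {μ : ℝ | ∃ v : n → ℝ, v ≠ 0 ∧ A.mulVec v = μ • v} := by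
    refine ((Set.finite_range hH.eigenvalues).subset ?_).bddBelow
    rintro μ ⟨v, hv, hAv⟩
    rw [← hH.spectrum_real_eq_range_eigenvalues, ← Matrix.spectrum_toLin']
    refine Module.End.HasEigenvalue.mem_spectrum
      (Module.End.hasEigenvalue_of_hasEigenvector (x := v) ⟨?_, hv⟩)
    rw [Module.End.mem_eigenspace_iff, Matrix.toLin'_apply, hAv]
  have hHc : (A - leastEig A • (1 : Matrix n n ℝ)).IsHermitian := by
    refine hH.sub ?_
    rw [Matrix.IsHermitian, Matrix.conjTranspose_eq_transpose_of_trivial]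
    simp
  have hpsd : (A - leastEig A • (1 : Matrix n n ℝ)).PosSemidef := by
    rw [hHc.posSemidef_iff_eigenvalues_nonneg]
    intro i
    have h1 := hHc.mulVec_eigenvectorBasis i
    have hne : (hHc.eigenvectorBasis i : n → ℝ) ≠ 0 := by
      intro h0
      refine hHc.eigenvectorBasis.orthonormal.ne_zero i ?_
      ext j
      exact congrFun h0 j
    have h2 : leastEig A ≤ hHc.eigenvalues i + leastEig A := by
      refine csInf_le hbdd ⟨_, hne, ?_⟩
      rw [add_smul, ← h1, Matrix.sub_mulVec, Matrix.smul_mulVec, Matrix.one_mulVec]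
      abel
    simpa using h2
  have := hpsd.dotProduct_mulVec_nonneg v
  simp only [star_trivial, Matrix.sub_mulVec, Matrix.smul_mulVec, Matrix.one_mulVec,
    dotProduct_sub, dotProduct_smul, smul_eq_mul] at this
  linarith

/-- The quadratic form of a symmetric matrix is bounded below through the `2 × 2` matrix built
from the norms of its off-diagonal blocks and the least eigenvalue of its last block. -/
lemma leastEig_block_mul_le {L : Matrix (Unit ⊕ n) (Unit ⊕ n) ℝ} (hL : Lᵀ = L)
    (d : Unit ⊕ n → ℝ) :
    leastEig !![L (Sum.inl ()) (Sum.inl ()), -specNorm L.toBlocks₁₂;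
      -specNorm L.toBlocks₂₁, leastEig L.toBlocks₂₂] *
      (d (Sum.inl ()) ^ 2 + ‖WithLp.toLp 2 (fun j => d (Sum.inr j))‖ ^ 2) ≤
      d ⬝ᵥ L.mulVec d := by
  have h21 : L.toBlocks₂₁ = L.toBlocks₁₂ᵀ := by
    ext i j
    exact (congrFun (congrFun hL (Sum.inr i)) (Sum.inl j)).symm
  have h22 : L.toBlocks₂₂ᵀ = L.toBlocks₂₂ := by
    ext i j
    exact congrFun (congrFun hL (Sum.inr i)) (Sum.inr j)
  set d1 : Unit → ℝ := fun j => d (Sum.inl j) with hd1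
  set d2 : n → ℝ := fun j => d (Sum.inr j) with hd2
  have hsplit : d ⬝ᵥ L.mulVec d = d1 ⬝ᵥ L.toBlocks₁₁.mulVec d1 + d1 ⬝ᵥ L.toBlocks₁₂.mulVec d2 +
      (d2 ⬝ᵥ L.toBlocks₂₁.mulVec d1 + d2 ⬝ᵥ L.toBlocks₂₂.mulVec d2) := by
    have hd : d = Sum.elim d1 d2 := (Sum.elim_comp_inl_inr d).symm
    conv_lhs => rw [← Matrix.fromBlocks_toBlocks L, hd]
    rw [Matrix.fromBlocks_mulVec, sumElim_dotProduct_sumElim]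
    simp [dotProduct_add, Function.comp_def]
  have hn1 : ‖WithLp.toLp 2 d1‖ = |d (Sum.inl ())| := by
    rw [EuclideanSpace.norm_eq]
    simp [hd1, Real.sqrt_sq_eq_abs]
  have h11 : d1 ⬝ᵥ L.toBlocks₁₁.mulVec d1 = L (Sum.inl ()) (Sum.inl ()) * d (Sum.inl ()) ^ 2 := by
    simp [dotProduct, Matrix.mulVec, Matrix.toBlocks₁₁, hd1]
    ring
  have hb12 := (abs_le.1 (abs_dotProduct_mulVec_le L.toBlocks₁₂ d1 d2)).1
  have hb21 := (abs_le.1 (abs_dotProduct_mulVec_le L.toBlocks₂₁ d2 d1)).1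
  have hb22 := leastEig_mul_le h22 d2
  rw [dotProduct_self_eq_norm_sq] at hb22
  -- The off-diagonal blocks are transposes of each other, so their spectral norms agree and the `2
  -- × 2` matrix is symmetric.
  have hsymm : (!![L (Sum.inl ()) (Sum.inl ()), -specNorm L.toBlocks₁₂;
      -specNorm L.toBlocks₂₁, leastEig L.toBlocks₂₂])ᵀ = !![L (Sum.inl ()) (Sum.inl ()),
      -specNorm L.toBlocks₁₂; -specNorm L.toBlocks₂₁, leastEig L.toBlocks₂₂] := by
    have : specNorm L.toBlocks₂₁ = specNorm L.toBlocks₁₂ := by rw [h21, specNorm_transpose]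
    ext i j
    fin_cases i <;> fin_cases j <;> simp [this]
  -- The `2 × 2` form is tested on the norms of the two blocks, where its off-diagonal terms are the
  -- worst case of the cross terms.
  have hB := leastEig_mul_le hsymm ![|d (Sum.inl ())|, ‖WithLp.toLp 2 d2‖]
  simp only [dotProduct, Matrix.mulVec, Fin.sum_univ_two, Matrix.of_apply, Matrix.cons_val_zero,
    Matrix.cons_val_one] at hB
  rw [hn1] at hb12 hb21
  rw [hsplit, h11]
  have hsq := sq_abs (d (Sum.inl ()))
  rw [← hsq]
  calc _ = _ := by ring
    _ ≤ _ := hB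
    _ = L (Sum.inl ()) (Sum.inl ()) * |d (Sum.inl ())| ^ 2 +
        -(|d (Sum.inl ())| * (specNorm L.toBlocks₁₂ * ‖WithLp.toLp 2 d2‖)) +
        (-(‖WithLp.toLp 2 d2‖ * (specNorm L.toBlocks₂₁ * |d (Sum.inl ())|)) +
          leastEig L.toBlocks₂₂ * ‖WithLp.toLp 2 d2‖ ^ 2) := by ring
    _ ≤ _ := by gcongr

end LinearAlgebra

/-! ### P-matrices with nonpositive off-diagonal entries -/

/-- Induction through the Schur complement of the first pivot, which keeps nonpositive off-diagonal
entries and positive principal minors. Minors are indexed by injections from `Fin k`, so that an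
index can be prepended. -/
lemma exists_pos_mulVec_pos_fin : ∀ (n : ℕ) (A : Matrix (Fin n) (Fin n) ℝ),
    (∀ i j, i ≠ j → A i j ≤ 0) →
    (∀ (k : ℕ) (e : Fin k → Fin n), Function.Injective e → 0 < (A.submatrix e e).det) →
    ∃ v : Fin n → ℝ, (∀ i, 0 < v i) ∧ ∀ i, 0 < A.mulVec v i
  | 0, _, _, _ => ⟨0, fun i => i.elim0, fun i => i.elim0⟩
  | n + 1, A, hZ, hP => by
    have ha : 0 < A 0 0 := by
      simpa using hP 1 (fun _ => 0) (Function.injective_of_subsingleton _)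
    set a := A 0 0 with ha_def
    let S : Matrix (Fin n) (Fin n) ℝ :=
      Matrix.of fun i j => A i.succ j.succ - A i.succ 0 * a⁻¹ * A 0 j.succ
    have hSP : ∀ (k : ℕ) (e : Fin k → Fin n), Function.Injective e →
        0 < (S.submatrix e e).det := by
      intro k e he
      -- Prepending the pivot index gives a minor of `A` equal to `a` times the minor of `S` at `e`.
      let e' : Fin (k + 1) → Fin (n + 1) := Fin.cons 0 (Fin.succ ∘ e)
      have he' : Function.Injective e' := by
        rw [Fin.cons_injective_iff]
        exact ⟨by rintro ⟨i, hi⟩; exact Fin.succ_ne_zero _ hi,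
          (Fin.succ_injective n).comp he⟩
      have hdet := hP (k + 1) e' he'
      let A11 : Matrix Unit Unit ℝ := Matrix.of fun _ _ => a
      let _ : Invertible A11 := ⟨Matrix.of fun _ _ => a⁻¹,
        by ext i j; simp [A11, Matrix.mul_apply, ha.ne'],
        by ext i j; simp [A11, Matrix.mul_apply, ha.ne']⟩
      let σ : Unit ⊕ Fin k ≃ Fin (k + 1) :=
        { toFun := Sum.elim (fun _ => 0) Fin.succ
          invFun := Fin.cons (Sum.inl ()) Sum.inr
          left_inv := by rintro (_ | i) <;> simp
          right_inv := by intro i; refine Fin.cases ?_ (fun i => ?_) i <;> simp }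
      rw [← Matrix.det_submatrix_equiv_self σ, show (A.submatrix e' e').submatrix σ σ =
        Matrix.fromBlocks A11 (Matrix.of fun _ j => A 0 (e j).succ)
          (Matrix.of fun i _ => A (e i).succ 0) (Matrix.of fun i j => A (e i).succ (e j).succ) by
          ext i j
          rcases i with i | i <;> rcases j with j | j <;> simp [σ, e', A11, ha_def],
        Matrix.det_fromBlocks₁₁] at hdet
      have h11 : A11.det = a := by simp [A11]
      rw [h11] at hdet
      refine (pos_of_mul_pos_right hdet ha.le).trans_eq ?_
      congr 1
      ext i j
      change A (e i).succ (e j).succ - _ = A (e i).succ (e j).succ - _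
      congr 1
      simp only [Matrix.mul_apply, Finset.univ_unique, Finset.sum_singleton, Matrix.of_apply]
      rfl
    have hSZ : ∀ i j, i ≠ j → S i j ≤ 0 := by
      intro i j hij
      have h1 := hZ i.succ j.succ (by simpa using hij)
      have h2 := hZ i.succ 0 (Fin.succ_ne_zero i)
      have h3 := hZ 0 j.succ (Fin.succ_ne_zero j).symm
      have h4 : 0 ≤ A i.succ 0 * a⁻¹ * A 0 j.succ :=
        mul_nonneg_of_nonpos_of_nonpos
          (mul_nonpos_of_nonpos_of_nonneg h2 (inv_nonneg.2 ha.le)) h3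
      simp only [S, Matrix.of_apply]
      linarith
    obtain ⟨u, hu, hSu⟩ := exists_pos_mulVec_pos_fin n S hSZ hSP
    -- The first row of the product will equal `ε`; row `i + 1` becomes `S.mulVec u i` plus a term
    -- proportional to `ε`, still positive for small `ε`.
    obtain ⟨ε, hε, hεS⟩ : ∃ ε : ℝ, 0 < ε ∧
        ∀ i, 0 < S.mulVec u i + A i.succ 0 * a⁻¹ * ε := by
      have hev : ∀ᶠ ε : ℝ in 𝓝[>] 0, ∀ i, 0 < S.mulVec u i + A i.succ 0 * a⁻¹ * ε := by
        rw [eventually_all]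
        intro i
        have hc : Continuous fun ε : ℝ => S.mulVec u i + A i.succ 0 * a⁻¹ * ε := by fun_prop
        have h0 := (hc.tendsto 0).eventually
          (lt_mem_nhds (a := 0) (by simpa using hSu i))
        exact nhdsWithin_le_nhds h0
      obtain ⟨ε, h1, h2⟩ := (hev.and self_mem_nhdsWithin).exists
      exact ⟨ε, h2, h1⟩
    set b : ℝ := ∑ j : Fin n, A 0 j.succ * u j with hb_def
    have hb : b ≤ 0 := Finset.sum_nonpos fun j _ =>
      mul_nonpos_of_nonpos_of_nonneg (hZ 0 j.succ (Fin.succ_ne_zero j).symm) (hu j).le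
    -- The first coordinate solves `a * v₀ + b = ε`; it is positive because `b ≤ 0`.
    refine ⟨Fin.cons (a⁻¹ * (ε - b)) u, fun i => ?_, fun i => ?_⟩
    · refine Fin.cases ?_ (fun i => ?_) i
      · have : 0 < ε - b := by linarith
        simp only [Fin.cons_zero]
        positivity
      · simpa using hu i
    · refine Fin.cases ?_ (fun i => ?_) i
      · have : A.mulVec (Fin.cons (a⁻¹ * (ε - b)) u) 0 = ε := by
          simp only [Matrix.mulVec, dotProduct, Fin.sum_univ_succ, Fin.cons_zero, Fin.cons_succ]
          rw [← ha_def, ← hb_def]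
          field_simp
          ring
        rw [this]
        exact hε
      · refine (hεS i).trans_eq ?_
        simp only [Matrix.mulVec, dotProduct, Fin.sum_univ_succ, Fin.cons_zero, Fin.cons_succ,
          S, Matrix.of_apply, sub_mul, Finset.sum_sub_distrib]
        have : ∑ j, A i.succ 0 * a⁻¹ * A 0 j.succ * u j = A i.succ 0 * a⁻¹ * b := by
          rw [hb_def, Finset.mul_sum]
          exact Finset.sum_congr rfl fun j _ => by ring
        rw [this]
        ring

lemma IsPMatrix.exists_pos_mulVec_pos {n : ℕ} {A : Matrix (Fin n) (Fin n) ℝ} (hP : IsPMatrix A)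
    (hZ : ∀ i j, i ≠ j → A i j ≤ 0) :
    ∃ v : Fin n → ℝ, (∀ i, 0 < v i) ∧ ∀ i, 0 < A.mulVec v i := by
  refine exists_pos_mulVec_pos_fin n A hZ fun k e he => ?_
  rcases Nat.eq_zero_or_pos k with rfl | hk
  · simp
  · let s : Finset (Fin n) := Finset.univ.map ⟨e, he⟩
    have hs : s.Nonempty := ⟨e ⟨0, hk⟩, by simp [s]⟩
    let σ : Fin k ≃ s := Equiv.ofBijective (fun i => ⟨e i, by simp [s]⟩)
      ⟨fun i j hij => he (by simpa using hij), fun ⟨x, hx⟩ => by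
        obtain ⟨i, -, hi⟩ := Finset.mem_map.1 hx
        exact ⟨i, Subtype.ext hi⟩⟩
    have := hP s hs
    rw [← Matrix.det_submatrix_equiv_self σ] at this
    exact this

end CognitiveRadio

namespace CognitiveRadio

open Set Filter Topology

/-! ### Strategy sets and payoffs -/

lemma continuous_sens {N : ℕ} : Continuous (Strategy.sens : Strategy N → ℝ) := continuous_apply _

lemma continuous_fa {N : ℕ} : Continuous (Strategy.fa : Strategy N → ℝ) := continuous_apply _

lemma continuous_pow {N : ℕ} (k : Fin N) : Continuous (fun y : Strategy N => y.pow k) :=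
  continuous_apply _

namespace System

variable {Q N : ℕ} (S : System Q N)

lemma noise_pos (q : Fin Q) (k : Fin N) : 0 < S.noise q k :=
  div_pos (S.noisePSD_pos q k) (by have := norm_pos_iff.2 (S.H_ne_zero q k); positivity)

lemma gain_nonneg (q r : Fin Q) (k : Fin N) : 0 ≤ S.gain q r k := sq_nonneg _

/-- The detection constraint on carrier `k` at the sensing time `s` bounds the false alarm
probability below by `qFun (faArg q k s)`. -/
noncomputable def faArg (q : Fin Q) (k : Fin N) (s : ℝ) : ℝ :=
  (S.sigma1 q k * S.alphaHat q k + (S.mu1 q k - S.mu0 q k) * s) / S.sigma0 q k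

lemma continuous_faArg (q : Fin Q) (k : Fin N) : Continuous (S.faArg q k) := by
  unfold faArg
  fun_prop

lemma detection_iff (q : Fin Q) (k : Fin N) {s e : ℝ} (h0 : 0 < e) (h1 : e < 1) :
    S.sigma0 q k / S.sigma1 q k * qInv e - s * ((S.mu1 q k - S.mu0 q k) / S.sigma1 q k) ≤
      S.alphaHat q k ↔ qFun (S.faArg q k s) ≤ e := by
  have hs0 := S.sigma0_pos q k
  have hs1 := S.sigma1_pos q k
  rw [← qInv_le_iff h0 h1, faArg, le_div_iff₀ hs0]
  rw [show S.sigma0 q k / S.sigma1 q k * qInv e - s * ((S.mu1 q k - S.mu0 q k) / S.sigma1 q k) =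
    (S.sigma0 q k * qInv e - s * (S.mu1 q k - S.mu0 q k)) / S.sigma1 q k by ring,
    div_le_iff₀ hs1]
  constructor <;> intro h <;> linarith

/-- Solving the detection constraint for the false alarm probability removes `qInv` and makes the
strict condition `0 < y.fa` automatic, since `qFun` is positive and there is at least one carrier.
Closedness and convexity become visible. -/
lemma mem_convSet_iff [NeZero N] (q : Fin Q) (y : Strategy N) :
    y ∈ S.convSet q ↔ (∀ k, qFun (S.faArg q k y.sens) ≤ y.fa) ∧ y.fa ≤ S.beta q ∧
      y.pow ∈ S.powerSet q ∧
      √(S.tauMin q * S.f q) ≤ y.sens ∧ y.sens ≤ √(S.tauMax q * S.f q) := by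
  have hβ := S.beta_le q
  constructor
  · rintro ⟨h0, h1, h2, h3, h4, h5⟩
    exact ⟨fun k => (S.detection_iff q k h0 (by linarith)).1 (h2 k), h1, h3, h4, h5⟩
  · rintro ⟨h2, h1, h3, h4, h5⟩
    have h0 : 0 < y.fa := (qFun_pos _).trans_le (h2 0)
    exact ⟨h0, h1, fun k => (S.detection_iff q k h0 (by linarith)).2 (h2 k), h3, h4, h5⟩

lemma convex_powerSet (q : Fin Q) : Convex ℝ (S.powerSet q) := by
  rintro p ⟨hp1, hp2⟩ p' ⟨hp1', hp2'⟩ a b ha hb hab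
  refine ⟨?_, fun k => ⟨?_, ?_⟩⟩
  · simp only [Pi.add_apply, Pi.smul_apply, smul_eq_mul, Finset.sum_add_distrib, ← Finset.mul_sum]
    calc _ ≤ a * S.budget q + b * S.budget q := by gcongr
      _ = _ := by rw [← add_mul, hab, one_mul]
  · have h1 := (hp2 k).1
    have h2 := (hp2' k).1
    simp only [Pi.add_apply, Pi.smul_apply, smul_eq_mul]
    positivity
  · have h1 := (hp2 k).2
    have h2 := (hp2' k).2
    simp only [Pi.add_apply, Pi.smul_apply, smul_eq_mul]
    calc _ ≤ a * S.pMax q k + b * S.pMax q k := by gcongr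
      _ = _ := by rw [← add_mul, hab, one_mul]

lemma convex_convSet [NeZero N] (q : Fin Q) : Convex ℝ (S.convSet q) := by
  intro y hy z hz a b ha hb hab
  rw [mem_convSet_iff] at hy hz ⊢
  obtain ⟨hy1, hy2, hy3, hy4, hy5⟩ := hy
  obtain ⟨hz1, hz2, hz3, hz4, hz5⟩ := hz
  have hβ := S.beta_le q
  have hfa : (a • y + b • z).fa = a * y.fa + b * z.fa := rfl
  have hsens : (a • y + b • z).sens = a * y.sens + b * z.sens := rfl
  rw [hfa, hsens]
  refine ⟨fun k => ?_, ?_, S.convex_powerSet q hy3 hz3 ha hb hab, ?_, ?_⟩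
  · have harg : ∀ s e : ℝ, qFun (S.faArg q k s) ≤ e → e ≤ S.beta q → 0 ≤ S.faArg q k s := by
      intro s e h1 h2
      refine strictAnti_qFun.le_iff_ge.1 ?_
      rw [qFun_zero]
      linarith
    have haff : S.faArg q k (a * y.sens + b * z.sens) =
        a * S.faArg q k y.sens + b * S.faArg q k z.sens := by
      have h1 : a = 1 - b := by linarith
      have := (S.sigma0_pos q k).ne'
      unfold faArg
      rw [h1]
      field_simp
      ring
    rw [haff]
    refine (convexOn_qFun.2 (harg _ _ (hy1 k) hy2) (harg _ _ (hz1 k) hz2) ha hb hab).trans ?_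
    simp only [smul_eq_mul]
    have := hy1 k
    have := hz1 k
    gcongr
  · calc _ ≤ a * S.beta q + b * S.beta q := by gcongr
      _ = _ := by rw [← add_mul, hab, one_mul]
  · calc _ = a * √(S.tauMin q * S.f q) + b * √(S.tauMin q * S.f q) := by
          rw [← add_mul, hab, one_mul]
      _ ≤ _ := by gcongr
  · calc _ ≤ a * √(S.tauMax q * S.f q) + b * √(S.tauMax q * S.f q) := by gcongr
      _ = _ := by rw [← add_mul, hab, one_mul]

lemma isClosed_convSet [NeZero N] (q : Fin Q) : IsClosed (S.convSet q) := by
  have h : S.convSet q = {y | (∀ k, qFun (S.faArg q k y.sens) ≤ y.fa) ∧ y.fa ≤ S.beta q ∧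
      (∑ k, y.pow k ≤ S.budget q ∧ ∀ k, 0 ≤ y.pow k ∧ y.pow k ≤ S.pMax q k) ∧
      √(S.tauMin q * S.f q) ≤ y.sens ∧ y.sens ≤ √(S.tauMax q * S.f q)} :=
    Set.ext fun y => S.mem_convSet_iff q y
  have closed_all : ∀ {P : Fin N → Strategy N → Prop}, (∀ k, IsClosed {y | P k y}) →
      IsClosed {y | ∀ k, P k y} := by
    intro P hP
    rw [ofPred_forall]
    exact isClosed_iInter hP
  rw [h]
  refine IsClosed.and (closed_all fun k => ?_) (IsClosed.and ?_ (IsClosed.and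
    (IsClosed.and ?_ (closed_all fun k => IsClosed.and ?_ ?_)) (IsClosed.and ?_ ?_)))
  · exact isClosed_le (continuous_qFun.comp ((S.continuous_faArg q k).comp continuous_sens))
      continuous_fa
  · exact isClosed_le continuous_fa continuous_const
  · exact isClosed_le (continuous_finsetSum _ fun k _ => continuous_pow k) continuous_const
  · exact isClosed_le continuous_const (continuous_pow k)
  · exact isClosed_le (continuous_pow k) continuous_const
  · exact isClosed_le continuous_const continuous_sens
  · exact isClosed_le continuous_sens continuous_const

lemma isCompact_convSet [NeZero N] (q : Fin Q) : IsCompact (S.convSet q) := by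
  refine (isCompact_Icc (a := (0 : Strategy N)) (b := Sum.elim
    (fun _ => √(S.tauMax q * S.f q)) (Sum.elim (S.pMax q) fun _ => S.beta q))).of_isClosed_subset
    (S.isClosed_convSet q) ?_
  rintro y ⟨h1, h2, -, h3, h4, h5⟩
  constructor
  · rintro (_ | k | _)
    · exact (Real.sqrt_nonneg _).trans h4
    · exact (h3.2 k).1
    · exact h1.le
  · rintro (_ | k | _)
    · exact h5
    · exact (h3.2 k).2
    · exact h2

lemma sens_pos {q : Fin Q} {y : Strategy N} (hy : y ∈ S.convSet q) : 0 < y.sens :=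
  (Real.sqrt_pos.2 (mul_pos (S.tauMin_pos q) (S.f_pos q))).trans_le hy.2.2.2.2.1

lemma T_pos (q : Fin Q) : 0 < S.T q :=
  ((S.tauMin_pos q).trans (S.tauMin_lt q)).trans (S.tauMax_lt q)

lemma time_pos {q : Fin Q} {y : Strategy N} (hy : y ∈ S.convSet q) :
    0 < 1 - y.sens ^ 2 / (S.f q * S.T q) := by
  have hf := S.f_pos q
  have hT := S.T_pos q
  have hτ := (S.tauMin_pos q).trans (S.tauMin_lt q)
  have h1 : y.sens ^ 2 ≤ S.tauMax q * S.f q := by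
    rw [← Real.sq_sqrt (mul_pos hτ hf).le]
    exact pow_le_pow_left₀ (S.sens_pos hy).le hy.2.2.2.2.2 2
  rw [sub_pos, div_lt_one (mul_pos hf hT)]
  nlinarith [S.tauMax_lt q]

lemma fa_lt_one {q : Fin Q} {y : Strategy N} (hy : y ∈ S.convSet q) : y.fa < 1 := by
  have := S.beta_le q
  linarith [hy.2.1]

lemma pow_nonneg {q : Fin Q} {y : Strategy N} (hy : y ∈ S.convSet q) (k : Fin N) :
    0 ≤ y.pow k := (hy.2.2.2.1.2 k).1

lemma missProb_pos (q : Fin Q) (k : Fin N) (y : Strategy N) : 0 < S.missProb q k y :=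
  sub_pos.2 (qFun_lt_one _)

/-- The detection constraint says exactly that the miss probability is at most `alpha`. This 1/2 is
the source of the factor 2 in `IsRefPower` and of `t / 2` in `etaRef`. -/
lemma missProb_le {q : Fin Q} {y : Strategy N} (hy : y ∈ S.convSet q) (k : Fin N) :
    S.missProb q k y ≤ 1 / 2 := by
  have h := hy.2.2.1 k
  have hα0 := S.alpha_pos q k
  have hα := S.alpha_le q k
  have h1 : (S.sigma0 q k * qInv y.fa - (S.mu1 q k - S.mu0 q k) * y.sens) / S.sigma1 q k ≤
      S.alphaHat q k := by
    refine le_trans (le_of_eq ?_) h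
    ring
  have h2 := strictAnti_qFun.antitone h1
  rw [alphaHat, qFun_qInv (by linarith) (by linarith)] at h2
  unfold missProb
  linarith

/-! ### Interference and rates -/

/-- Noise plus interference at the receiver of user `q` on carrier `k`. -/
noncomputable def interf (q : Fin Q) (k : Fin N) (x : Profile Q N) : ℝ :=
  S.noise q k + ∑ r ∈ Finset.univ.erase q, S.gain q r k * (x r).pow k

/-- Sum of the rates of user `q`. -/
noncomputable def sumRate (q : Fin Q) (x : Profile Q N) : ℝ := ∑ k, S.rate q k x

lemma rate_eq (q : Fin Q) (k : Fin N) (x : Profile Q N) :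
    S.rate q k x = Real.log (1 + (x q).pow k / S.interf q k x) := rfl

lemma throughput_eq (q : Fin Q) (x : Profile Q N) :
    S.throughput q x =
      (1 - (x q).sens ^ 2 / (S.f q * S.T q)) * ((1 - (x q).fa) * S.sumRate q x) := by
  rw [throughput, sumRate, ← Finset.mul_sum]

variable {S}

lemma noise_le_interf {x : Profile Q N} {q : Fin Q} (hx : ∀ r, r ≠ q → x r ∈ S.convSet r)
    (k : Fin N) : S.noise q k ≤ S.interf q k x := by
  refine le_add_of_nonneg_right (Finset.sum_nonneg fun r hr => ?_)
  exact mul_nonneg (S.gain_nonneg q r k) (S.pow_nonneg (hx r (Finset.ne_of_mem_erase hr)) k)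

lemma interf_pos {x : Profile Q N} {q : Fin Q} (hx : ∀ r, r ≠ q → x r ∈ S.convSet r)
    (k : Fin N) : 0 < S.interf q k x := (S.noise_pos q k).trans_le (noise_le_interf hx k)

lemma interf_le {x : Profile Q N} {q : Fin Q} (hx : ∀ r, r ≠ q → x r ∈ S.convSet r)
    (k : Fin N) :
    S.interf q k x ≤ S.noise q k + ∑ r ∈ Finset.univ.erase q, S.gain q r k * S.pMax r k := by
  unfold interf
  gcongr with r hr
  · exact S.gain_nonneg q r k
  · exact ((hx r (Finset.ne_of_mem_erase hr)).2.2.2.1.2 k).2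

lemma rate_nonneg {x : Profile Q N} (hx : x ∈ S.convProd) (q : Fin Q) (k : Fin N) :
    0 ≤ S.rate q k x := by
  rw [rate_eq]
  refine Real.log_nonneg ?_
  have h1 := interf_pos (q := q) (fun r _ => hx r) k
  have h2 := S.pow_nonneg (hx q) k
  have : 0 ≤ (x q).pow k / S.interf q k x := by positivity
  linarith

lemma sumRate_pos {x : Profile Q N} (hx : x ∈ S.convProd) {q : Fin Q} (hq : (x q).pow ≠ 0) :
    0 < S.sumRate q x := by
  obtain ⟨k, hk⟩ := Function.ne_iff.1 hq
  refine Finset.sum_pos' (fun k _ => rate_nonneg hx q k) ⟨k, Finset.mem_univ k, ?_⟩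
  rw [rate_eq]
  refine Real.log_pos ?_
  have h1 := interf_pos (q := q) (fun r _ => hx r) k
  have h2 : 0 < (x q).pow k := lt_of_le_of_ne (S.pow_nonneg (hx q) k) (Ne.symm hk)
  have : 0 < (x q).pow k / S.interf q k x := by positivity
  linarith

/-- Inside `Y` the convention `log 0 = -∞` is triggered only by zero power. -/
lemma throughput_pos_iff {x : Profile Q N} (hx : x ∈ S.convProd) {q : Fin Q} :
    0 < S.throughput q x ↔ (x q).pow ≠ 0 := by
  have h1 := S.time_pos (hx q)
  have h2 := sub_pos.2 (S.fa_lt_one (hx q))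
  rw [throughput_eq]
  constructor
  · rintro h h0
    have : S.sumRate q x = 0 := by simp [sumRate, rate_eq, h0]
    simp [this] at h
  · intro h
    exact mul_pos h1 (mul_pos h2 (sumRate_pos hx h))

/-- By `log (1 + u) ≤ u`, a lower bound on the rate becomes a lower bound on the total power. -/
lemma sumRate_le [NeZero N] {x : Profile Q N} (hx : x ∈ S.convProd) (q : Fin Q) :
    S.sumRate q x ≤ (∑ k, (x q).pow k) / ⨅ k, S.noise q k := by
  rw [sumRate, Finset.sum_div]
  refine Finset.sum_le_sum fun k _ => ?_
  have hmin : 0 < ⨅ k, S.noise q k := by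
    obtain ⟨k, hk⟩ := exists_eq_ciInf_of_finite (f := S.noise q)
    rw [← hk]
    exact S.noise_pos q k
  have h1 := interf_pos (q := q) (fun r _ => hx r) k
  have h2 := S.pow_nonneg (hx q) k
  have h3 : ⨅ k, S.noise q k ≤ S.interf q k x :=
    (ciInf_le (Set.finite_range _).bddBelow k).trans (noise_le_interf (fun r _ => hx r) k)
  have h4 : 0 ≤ (x q).pow k / S.interf q k x := by positivity
  calc S.rate q k x ≤ 1 + (x q).pow k / S.interf q k x - 1 :=
        Real.log_le_sub_one_of_pos (by change 0 < 1 + (x q).pow k / S.interf q k x; linarith)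
    _ = (x q).pow k / S.interf q k x := by ring
    _ ≤ _ := by gcongr

/-! ### Smoothness -/

lemma contDiff_coord (q : Fin Q) (i : Coord N) :
    ContDiff ℝ 2 (fun x : Profile Q N => x q i) := by fun_prop

lemma contDiff_sens (q : Fin Q) : ContDiff ℝ 2 (fun x : Profile Q N => (x q).sens) :=
  contDiff_coord q _

lemma contDiff_fa (q : Fin Q) : ContDiff ℝ 2 (fun x : Profile Q N => (x q).fa) :=
  contDiff_coord q _

lemma contDiff_pow (q : Fin Q) (k : Fin N) :
    ContDiff ℝ 2 (fun x : Profile Q N => (x q).pow k) := contDiff_coord q _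

lemma contDiff_interf (q : Fin Q) (k : Fin N) : ContDiff ℝ 2 (S.interf q k) :=
  contDiff_const.add (ContDiff.sum fun r _ => contDiff_const.mul (contDiff_pow r k))

lemma contDiffAt_rate {x : Profile Q N} (hx : x ∈ S.convProd) (q : Fin Q) (k : Fin N) :
    ContDiffAt ℝ 2 (S.rate q k) x := by
  have h1 := interf_pos (q := q) (fun r _ => hx r) k
  have h2 := S.pow_nonneg (hx q) k
  have h3 : 0 ≤ (x q).pow k / S.interf q k x := by positivity
  exact (contDiffAt_const.add ((contDiff_pow q k).contDiffAt.div
    (contDiff_interf q k).contDiffAt h1.ne')).log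
      (by change 1 + (x q).pow k / S.interf q k x ≠ 0; linarith)

lemma contDiffAt_sumRate {x : Profile Q N} (hx : x ∈ S.convProd) (q : Fin Q) :
    ContDiffAt ℝ 2 (S.sumRate q) x :=
  ContDiffAt.sum fun k _ => contDiffAt_rate hx q k

/-- The equi-sensing penalty. -/
noncomputable def penalty (S : System Q N) (c : ℝ) (q : Fin Q) (x : Profile Q N) : ℝ :=
  c / 2 * ((x q).sens / √(S.f q) - 1 / (Q : ℝ) * ∑ r, (x r).sens / √(S.f r)) ^ 2

lemma theta_eq (c : ℝ) (q : Fin Q) (x : Profile Q N) :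
    S.theta c q x = Real.log (S.throughput q x) - S.penalty c q x := rfl

lemma contDiff_penalty (c : ℝ) (q : Fin Q) : ContDiff ℝ 2 (S.penalty c q) := by
  refine contDiff_const.mul (ContDiff.pow (ContDiff.sub ((contDiff_sens q).div_const _) ?_) 2)
  exact contDiff_const.mul (ContDiff.sum fun r _ => (contDiff_sens r).div_const _)

lemma contDiffAt_throughput {x : Profile Q N} (hx : x ∈ S.convProd) (q : Fin Q) :
    ContDiffAt ℝ 2 (S.throughput q) x := by
  have h : S.throughput q = fun x =>
      (1 - (x q).sens ^ 2 / (S.f q * S.T q)) * ((1 - (x q).fa) * S.sumRate q x) :=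
    funext fun x => S.throughput_eq q x
  rw [h]
  exact (contDiffAt_const.sub (((contDiff_sens q).pow 2).div_const _).contDiffAt).mul
    ((contDiffAt_const.sub (contDiff_fa q).contDiffAt).mul (contDiffAt_sumRate hx q))

lemma contDiffAt_theta {x : Profile Q N} (hx : x ∈ S.convProd) {q : Fin Q}
    (hq : (x q).pow ≠ 0) (c : ℝ) : ContDiffAt ℝ 2 (S.theta c q) x :=
  ((contDiffAt_throughput hx q).log ((throughput_pos_iff hx).2 hq).ne').sub
    (contDiff_penalty c q).contDiffAt

lemma contDiffAt_missProb {x : Profile Q N} {q : Fin Q} (hx : x q ∈ S.convSet q) (k : Fin N) :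
    ContDiffAt ℝ 2 (fun x : Profile Q N => S.missProb q k (x q)) x := by
  have h1 : ContDiffAt ℝ 2 (fun x : Profile Q N => qInv (x q).fa) x :=
    (contDiffAt_qInv hx.1 (S.fa_lt_one hx)).comp x (contDiff_fa q).contDiffAt
  exact contDiffAt_const.sub (contDiff_qFun.contDiffAt.comp x
    (((contDiffAt_const.mul h1).sub (contDiff_const.mul (contDiff_sens q)).contDiffAt).div_const _))

lemma contDiffAt_locInt {x : Profile Q N} {q : Fin Q} (hx : x q ∈ S.convSet q) :
    ContDiffAt ℝ 2 (fun x : Profile Q N => S.locInt q (x q)) x :=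
  (ContDiffAt.sum fun k _ => ((contDiffAt_missProb hx k).mul contDiffAt_const).mul
    (contDiff_pow q k).contDiffAt).sub contDiffAt_const

lemma contDiffAt_globInt {x : Profile Q N} (hx : x ∈ S.convProd) :
    ContDiffAt ℝ 2 S.globInt x :=
  (ContDiffAt.sum fun k _ => ContDiffAt.sum fun q _ =>
    ((contDiffAt_missProb (hx q) k).mul contDiffAt_const).mul
      (contDiff_pow q k).contDiffAt).sub contDiffAt_const

lemma contDiffAt_lagrangian {x : Profile Q N} (hx : x ∈ S.convProd) {q : Fin Q}
    (hq : (x q).pow ≠ 0) (c price m : ℝ) : ContDiffAt ℝ 2 (S.lagrangian c price m q) x :=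
  ((contDiffAt_theta hx hq c).neg.add (contDiffAt_const.mul (contDiffAt_locInt (hx q)))).add
    (contDiffAt_const.mul (contDiffAt_globInt hx))

end System

end CognitiveRadio

/-! ### A multiplier rule on convex sets -/

namespace CognitiveRadio

open Set Filter Topology

/-- A multiplier rule for two linear functionals on a convex set. -/
lemma exists_multiplier_of_convex {E : Type*} [AddCommGroup E] [Module ℝ E] {C : Set E}
    (hC : Convex ℝ C) {y z₀ : E} (f g : E →ₗ[ℝ] ℝ) (hz₀ : z₀ ∈ C) (hg₀ : g (z₀ - y) < 0)
    (h : ∀ z ∈ C, g (z - y) < 0 → 0 ≤ f (z - y)) :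
    ∃ m : ℝ, 0 ≤ m ∧ ∀ z ∈ C, 0 ≤ f (z - y) + m * g (z - y) := by
  have hcomb : ∀ z z' : E, ∀ a b : ℝ, a + b = 1 →
      a • z + b • z' - y = a • (z - y) + b • (z' - y) := by
    intro z z' a b hab
    have : y = (a + b) • y := by rw [hab, one_smul]
    conv_lhs => rw [this]
    module
  -- Directions with `g = 0` are limits of directions tilted slightly toward `z₀`, where `g` is
  -- negative.
  have hzero : ∀ z ∈ C, g (z - y) = 0 → 0 ≤ f (z - y) := by
    intro z hz hgz
    have hev : ∀ᶠ ε : ℝ in 𝓝[>] 0, 0 ≤ (1 - ε) * f (z - y) + ε * f (z₀ - y) := by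
      filter_upwards [Ioo_mem_nhdsGT (zero_lt_one (α := ℝ))] with ε hε
      have hmem := hC hz hz₀ (sub_nonneg.2 hε.2.le) hε.1.le (by ring)
      have h1 := h _ hmem
      rw [hcomb _ _ _ _ (by ring)] at h1
      simp only [map_add, map_smul, smul_eq_mul, hgz, mul_zero, zero_add] at h1
      exact h1 (mul_neg_of_pos_of_neg hε.1 hg₀)
    have hc : Continuous fun ε : ℝ => (1 - ε) * f (z - y) + ε * f (z₀ - y) := by fun_prop
    have hl := (hc.tendsto 0).mono_left (nhdsWithin_le_nhds (s := Ioi 0))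
    simp only [sub_zero, one_mul, zero_mul, add_zero] at hl
    exact ge_of_tendsto hl hev
  -- The multiplier is the infimum of the ratios `f / (-g)` over directions with `g < 0`, the
  -- largest value these directions allow.
  set A : Set ℝ := (fun z => f (z - y) / (-g (z - y))) '' {z | z ∈ C ∧ g (z - y) < 0} with hA
  have hAne : A.Nonempty := ⟨_, z₀, ⟨hz₀, hg₀⟩, rfl⟩
  have hA0 : ∀ a ∈ A, 0 ≤ a := by
    rintro _ ⟨z, ⟨hz, hgz⟩, rfl⟩
    exact div_nonneg (h z hz hgz) (neg_pos.2 hgz).le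
  refine ⟨sInf A, le_csInf hAne hA0, fun z hz => ?_⟩
  rcases lt_trichotomy (g (z - y)) 0 with hgz | hgz | hgz
  · have h1 : sInf A ≤ f (z - y) / (-g (z - y)) := csInf_le ⟨0, hA0⟩ ⟨z, ⟨hz, hgz⟩, rfl⟩
    rw [le_div_iff₀ (neg_pos.2 hgz)] at h1
    linarith
  · rw [hgz, mul_zero, add_zero]
    exact hzero z hz hgz
  · have h1 : -f (z - y) / g (z - y) ≤ sInf A := by
      refine le_csInf hAne ?_
      rintro _ ⟨w, ⟨hw, hgw⟩, rfl⟩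
      -- If `g` is positive toward `z` and negative toward `w`, a convex combination of the two
      -- points has `g = 0`, and `hzero` compares the two ratios.
      have hpos : 0 < g (z - y) - g (w - y) := by linarith
      have hsum : -g (w - y) / (g (z - y) - g (w - y)) +
          g (z - y) / (g (z - y) - g (w - y)) = 1 := by
        field_simp
        ring
      have hmem := hC hz hw (div_nonneg (neg_pos.2 hgw).le hpos.le)
        (div_nonneg hgz.le hpos.le) hsum
      have h2 := hzero _ hmem
      rw [hcomb _ _ _ _ hsum] at h2
      simp only [map_add, map_smul, smul_eq_mul] at h2
      have h3 := h2 (by field_simp; ring)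
      have h4 : 0 ≤ -g (w - y) * f (z - y) + g (z - y) * f (w - y) := by
        have := mul_nonneg h3 hpos.le
        have h5 : (-g (w - y) / (g (z - y) - g (w - y)) * f (z - y) +
          g (z - y) / (g (z - y) - g (w - y)) * f (w - y)) * (g (z - y) - g (w - y)) =
          -g (w - y) * f (z - y) + g (z - y) * f (w - y) := by
          field_simp
        rwa [h5] at this
      rw [div_le_div_iff₀ hgz (neg_pos.2 hgw)]
      linarith
    rw [div_le_iff₀ hgz] at h1
    linarith

/-- The strategy `y` with its power allocation replaced by `p`. -/
def Strategy.withPow {N : ℕ} (y : Strategy N) (p : Fin N → ℝ) : Strategy N :=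
  Sum.elim (fun _ => y.sens) (Sum.elim p fun _ => y.fa)

lemma Strategy.withPow_pow {N : ℕ} (y : Strategy N) : y.withPow y.pow = y := by
  funext i
  rcases i with _ | i | _ <;> rfl

/-! ### Existence and size of best responses -/

namespace System

variable {Q N : ℕ} {S : System Q N}

lemma withPow_mem {q : Fin Q} {y : Strategy N} (hy : y ∈ S.convSet q) {p : Fin N → ℝ}
    (hp : p ∈ S.powerSet q) : y.withPow p ∈ S.convSet q :=
  ⟨hy.1, hy.2.1, hy.2.2.1, hp, hy.2.2.2.2⟩

lemma update_mem {q : Fin Q} {x : Profile Q N} (hx : ∀ r, r ≠ q → x r ∈ S.convSet r)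
    {y : Strategy N} (hy : y ∈ S.convSet q) : Function.update x q y ∈ S.convProd := by
  intro r
  by_cases hr : r = q
  · subst hr; simpa using hy
  · simpa [hr] using hx r hr

lemma locInt_withPow_smul (q : Fin Q) (y : Strategy N) (a : ℝ) :
    S.locInt q (y.withPow (a • y.pow)) = a * (S.locInt q y + S.locMax q) - S.locMax q := by
  have : S.locInt q (y.withPow (a • y.pow)) =
      ∑ k, S.missProb q k y * S.w q k * (a * y.pow k) - S.locMax q := rfl
  rw [this, locInt, sub_add_cancel, Finset.mul_sum]
  congr 1
  exact Finset.sum_congr rfl fun k _ => by ring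

/-- The terms of the other players do not involve the strategy of `q`. The difference is therefore
independent of the opponents, which later makes the price term cancel. -/
lemma globInt_update_sub (q : Fin Q) (x : Profile Q N) (y z : Strategy N) :
    S.globInt (Function.update x q y) - S.globInt (Function.update x q z) =
      S.locInt q y - S.locInt q z := by
  have h : ∀ y, S.globInt (Function.update x q y) = ∑ k, S.missProb q k y * S.w q k * y.pow k +
      (∑ r ∈ Finset.univ.erase q, ∑ k, S.missProb r k (x r) * S.w r k * (x r).pow k -
        S.globMax) := by
    intro y
    rw [globInt, Finset.sum_comm, ← Finset.add_sum_erase _ _ (Finset.mem_univ q), add_sub_assoc]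
    simp only [Function.update_self]
    congr 2
    refine Finset.sum_congr rfl fun r hr => ?_
    simp [Finset.ne_of_mem_erase hr]
  rw [h, h, locInt, locInt]
  ring

lemma penalty_withPow (c : ℝ) (q : Fin Q) (x : Profile Q N) (y : Strategy N) (p : Fin N → ℝ) :
    S.penalty c q (Function.update x q (y.withPow p)) =
      S.penalty c q (Function.update x q y) := by
  have h : ∀ r, (Function.update x q (y.withPow p) r).sens = (Function.update x q y r).sens := by
    intro r
    by_cases hr : r = q
    · subst hr; simp only [Function.update_self]; rfl
    · simp [hr]
  simp only [penalty, h]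

/-- The quantity that player `q` minimizes. -/
noncomputable def cost (S : System Q N) (c price : ℝ) (q : Fin Q) (x : Profile Q N) : ℝ :=
  -S.theta c q x + price * S.globInt x

lemma contDiffAt_cost {x : Profile Q N} (hx : x ∈ S.convProd) {q : Fin Q}
    (hq : (x q).pow ≠ 0) (c price : ℝ) : ContDiffAt ℝ 2 (S.cost c price q) x :=
  (contDiffAt_theta hx hq c).neg.add (contDiffAt_const.mul (contDiffAt_globInt hx))

lemma objective_eq {x : Profile Q N} (hx : x ∈ S.convProd) {q : Fin Q} (hq : (x q).pow ≠ 0)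
    (c price : ℝ) : S.objective c price q x = ((-S.cost c price q x : ℝ) : EReal) := by
  rw [objective, if_pos ((throughput_pos_iff hx).2 hq), cost]
  congr 1
  ring

lemma objective_eq_bot {x : Profile Q N} (hx : x ∈ S.convProd) {q : Fin Q} (hq : (x q).pow = 0)
    (c price : ℝ) : S.objective c price q x = ⊥ := by
  rw [objective, if_neg]
  rw [throughput_pos_iff hx]
  exact fun h => h hq

lemma continuousOn_update_of {q : Fin Q} {x : Profile Q N} {f : Profile Q N → ℝ}
    (hx : ∀ r, r ≠ q → x r ∈ S.convSet r) (hf : ∀ x ∈ S.convProd, ContDiffAt ℝ 2 f x) :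
    ContinuousOn (fun y => f (Function.update x q y)) (S.convSet q) := by
  intro y hy
  have h1 : ContinuousAt (fun y : Strategy N => Function.update x q y) y :=
    (continuous_const.update q continuous_id).continuousAt
  exact ((hf _ (update_mem hx hy)).continuousAt.comp
    (f := fun y : Strategy N => Function.update x q y) h1).continuousWithinAt

lemma isCompact_stratSet [NeZero N] {q : Fin Q} {x : Profile Q N}
    (hx : ∀ r, r ≠ q → x r ∈ S.convSet r) : IsCompact (S.stratSet q) := by
  have h1 : ContinuousOn (S.locInt q) (S.convSet q) := by
    have := continuousOn_update_of hx (f := fun x => S.locInt q (x q))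
      fun x hx => contDiffAt_locInt (hx q)
    simpa using this
  exact (S.isCompact_convSet q).of_isClosed_subset
    (h1.preimage_isClosed_of_isClosed (S.isClosed_convSet q) isClosed_Iic) fun y hy => hy.1

lemma withPow_ref_mem {q : Fin Q} {y : Strategy N} (hy : y ∈ S.convSet q) {p : Fin N → ℝ}
    (hp : S.IsRefPower q p) : y.withPow p ∈ S.stratSet q := by
  refine ⟨withPow_mem hy hp.1, ?_⟩
  have h : ∑ k, S.missProb q k y * S.w q k * p k ≤ ∑ k, 1 / 2 * (S.w q k * p k) := by
    refine Finset.sum_le_sum fun k _ => ?_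
    rw [mul_assoc]
    have := S.missProb_le hy k
    have := S.w_pos q k
    have := (hp.1.2 k).1
    gcongr
  rw [← Finset.mul_sum] at h
  have h2 := hp.2.2
  change ∑ k, S.missProb q k y * S.w q k * p k - S.locMax q ≤ 0
  linarith

variable {q : Fin Q} {x : Profile Q N} {c price : ℝ} {p : Fin N → ℝ}

/-- The exponential of the objective, throughput times an exponential factor, is continuous even at
zero power, where the objective itself is `⊥`; it attains its maximum on the compact strategy set.
-/
lemma exists_isOptimal [NeZero N] (hx : ∀ r, r ≠ q → x r ∈ S.convSet r)
    (hX : (S.stratSet q).Nonempty) : ∃ y, S.IsOptimal c price q x y := by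
  have hcont : ContinuousOn (fun y => S.throughput q (Function.update x q y) *
      Real.exp (-S.penalty c q (Function.update x q y) -
        price * S.globInt (Function.update x q y))) (S.stratSet q) := by
    refine (continuousOn_update_of hx (f := fun x => S.throughput q x *
      Real.exp (-S.penalty c q x - price * S.globInt x)) fun x hx => ?_).mono fun y hy => hy.1
    exact (contDiffAt_throughput hx q).mul (((contDiff_penalty c q).contDiffAt.neg.sub
      (contDiffAt_const.mul (contDiffAt_globInt hx))).exp)
  obtain ⟨y, hy, hmax⟩ := (isCompact_stratSet hx).exists_isMaxOn hX hcont
  refine ⟨y, hy, fun z hz => ?_⟩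
  by_cases hzp : z.pow = 0
  · rw [objective_eq_bot (update_mem hx hz.1) (by simpa using hzp)]
    exact bot_le
  · have hz' := update_mem hx hz.1
    have hy' := update_mem hx hy.1
    have htz := (throughput_pos_iff hz' (q := q)).2 (by simpa using hzp)
    have hle := hmax hz
    simp only [mem_ofPred_eq] at hle
    -- The maximal value is at least the positive value at `z`.
    have hty : 0 < S.throughput q (Function.update x q y) := by
      by_contra hneg
      have h1 := mul_pos htz (Real.exp_pos (-S.penalty c q (Function.update x q z) -
        price * S.globInt (Function.update x q z)))
      have h2 := mul_nonpos_of_nonpos_of_nonneg (not_lt.1 hneg)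
        (Real.exp_pos (-S.penalty c q (Function.update x q y) -
          price * S.globInt (Function.update x q y))).le
      linarith
    rw [objective, objective, if_pos htz, if_pos hty, EReal.coe_le_coe_iff, theta_eq, theta_eq]
    have h3 := Real.log_le_log (by positivity) hle
    rw [Real.log_mul htz.ne' (Real.exp_pos _).ne', Real.log_mul hty.ne' (Real.exp_pos _).ne',
      Real.log_exp, Real.log_exp] at h3
    linarith

/-- Zero power has payoff `⊥`, whereas the reference powers give a finite payoff. -/
lemma IsOptimal.pow_ne_zero {y : Strategy N} (h : S.IsOptimal c price q x y)
    (hx : ∀ r, r ≠ q → x r ∈ S.convSet r) (hp : S.IsRefPower q p) : y.pow ≠ 0 := by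
  intro h0
  have hz := withPow_ref_mem h.1.1 hp
  have h1 := h.2 _ hz
  rw [objective_eq_bot (update_mem hx h.1.1) (by simpa using h0),
    objective_eq (update_mem hx hz.1) (by rw [Function.update_self]; exact hp.2.1)] at h1
  simp at h1

lemma IsOptimal.cost_le {y : Strategy N} (h : S.IsOptimal c price q x y)
    (hx : ∀ r, r ≠ q → x r ∈ S.convSet r) (hp : S.IsRefPower q p) {z : Strategy N}
    (hz : z ∈ S.stratSet q) (hz0 : z.pow ≠ 0) :
    S.cost c price q (Function.update x q y) ≤ S.cost c price q (Function.update x q z) := by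
  have h1 := h.2 z hz
  rw [objective_eq (update_mem hx h.1.1) (by simpa using h.pow_ne_zero hx hp),
    objective_eq (update_mem hx hz.1) (by simpa using hz0), EReal.coe_le_coe_iff] at h1
  linarith

lemma log_throughput {x : Profile Q N} (hx : x ∈ S.convProd) (hq : (x q).pow ≠ 0) :
    Real.log (S.throughput q x) = Real.log (1 - (x q).sens ^ 2 / (S.f q * S.T q)) +
      (Real.log (1 - (x q).fa) + Real.log (S.sumRate q x)) := by
  have h1 := S.time_pos (hx q)
  have h2 := sub_pos.2 (S.fa_lt_one (hx q))
  have h3 := sumRate_pos hx hq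
  rw [throughput_eq, Real.log_mul h1.ne' (mul_pos h2 h3).ne', Real.log_mul h2.ne' h3.ne']

/-- When only the powers change, the penalty and the time and false alarm factors cancel. -/
lemma cost_withPow_sub (hx : ∀ r, r ≠ q → x r ∈ S.convSet r) {y : Strategy N}
    (hy : y ∈ S.convSet q) (hy0 : y.pow ≠ 0) {p : Fin N → ℝ} (hp : p ∈ S.powerSet q)
    (hp0 : p ≠ 0) :
    S.cost c price q (Function.update x q (y.withPow p)) -
        S.cost c price q (Function.update x q y) =
      Real.log (S.sumRate q (Function.update x q y)) -
        Real.log (S.sumRate q (Function.update x q (y.withPow p))) +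
        price * (S.locInt q (y.withPow p) - S.locInt q y) := by
  rw [cost, cost, theta_eq, theta_eq, penalty_withPow,
    log_throughput (update_mem hx (withPow_mem hy hp)) (by rw [Function.update_self]; exact hp0),
    log_throughput (update_mem hx hy) (by simpa using hy0), ← globInt_update_sub q x]
  simp only [Function.update_self]
  have h1 : (y.withPow p).sens = y.sens := rfl
  have h2 : (y.withPow p).fa = y.fa := rfl
  rw [h1, h2]
  ring

lemma interf_update (x : Profile Q N) (q : Fin Q) (y : Strategy N) (k : Fin N) :
    S.interf q k (Function.update x q y) = S.interf q k x := by
  unfold interf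
  congr 1
  exact Finset.sum_congr rfl fun r hr => by simp [Finset.ne_of_mem_erase hr]

lemma sumRate_update (x : Profile Q N) (q : Fin Q) (y : Strategy N) :
    S.sumRate q (Function.update x q y) =
      ∑ k, Real.log (1 + y.pow k / S.interf q k x) := by
  simp only [sumRate, rate_eq, interf_update, Function.update_self]

/-- An optimal strategy uses at least the total power that defines `convSetLow`. -/
lemma IsOptimal.mem_convSetLow [NeZero N] {t : ℝ} {pRef : Fin Q → Fin N → ℝ} {y : Strategy N}
    (h : S.IsOptimal c price q x y) (hprice : 0 ≤ price) (hpt : price ≤ t)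
    (hx : ∀ r, r ≠ q → x r ∈ S.convSet r) (hp : S.IsRefPower q (pRef q)) :
    y ∈ S.convSetLow t pRef q := by
  refine ⟨h.1.1, ?_⟩
  have hy := h.1.1
  have hy0 := h.pow_ne_zero hx hp
  have hcost := h.cost_le hx hp (withPow_ref_mem hy hp) hp.2.1
  have hsub := cost_withPow_sub (c := c) (price := price) hx hy hy0 hp.1 hp.2.1
  have hwp : 0 ≤ ∑ k, S.w q k * pRef q k :=
    Finset.sum_nonneg fun k _ => mul_nonneg (S.w_pos q k).le (hp.1.2 k).1
  -- The reference powers cause at most half of their weighted sum in interference, and those of `y`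
  -- at least none.
  have hloc : S.locInt q (y.withPow (pRef q)) - S.locInt q y ≤
      1 / 2 * ∑ k, S.w q k * pRef q k := by
    have h1 : ∑ k, S.missProb q k y * S.w q k * pRef q k ≤ 1 / 2 * ∑ k, S.w q k * pRef q k := by
      rw [Finset.mul_sum]
      refine Finset.sum_le_sum fun k _ => ?_
      rw [mul_assoc]
      have := S.missProb_le hy k
      have := S.w_pos q k
      have := (hp.1.2 k).1
      gcongr
    have h2 : 0 ≤ ∑ k, S.missProb q k y * S.w q k * y.pow k :=
      Finset.sum_nonneg fun k _ => mul_nonneg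
        (mul_nonneg (S.missProb_pos q k y).le (S.w_pos q k).le) (S.pow_nonneg hy k)
    have h3 : S.locInt q (y.withPow (pRef q)) =
      ∑ k, S.missProb q k y * S.w q k * pRef q k - S.locMax q := rfl
    rw [h3, locInt]
    linarith
  have hprod : price * (S.locInt q (y.withPow (pRef q)) - S.locInt q y) ≤
      t / 2 * ∑ k, S.w q k * pRef q k :=
    calc _ ≤ price * (1 / 2 * ∑ k, S.w q k * pRef q k) := by gcongr
      _ ≤ t * (1 / 2 * ∑ k, S.w q k * pRef q k) := by gcongr
      _ = _ := by ring
  -- The logarithms of the time and false alarm factors only lower `etaRef`, so knowing their sign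
  -- is enough.
  have hτ : Real.log (1 - S.tauMax q / S.T q) ≤ 0 := by
    have h1 : S.tauMax q / S.T q < 1 := (div_lt_one (S.T_pos q)).2 (S.tauMax_lt q)
    have h2 : 0 < S.tauMax q / S.T q :=
      div_pos ((S.tauMin_pos q).trans (S.tauMin_lt q)) (S.T_pos q)
    exact Real.log_nonpos (by linarith) (by linarith)
  have hfa : Real.log (1 - S.faRef q) ≤ 0 := by
    obtain ⟨k, hk⟩ := exists_eq_ciSup_of_finite (f := fun k => qFun ((S.sigma1 q k *
      S.alphaHat q k + (S.mu1 q k - S.mu0 q k) * √(S.f q * S.tauMin q)) / S.sigma0 q k))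
    have h0 : S.faRef q = _ := hk.symm
    have h1 := qFun_pos ((S.sigma1 q k * S.alphaHat q k +
      (S.mu1 q k - S.mu0 q k) * √(S.f q * S.tauMin q)) / S.sigma0 q k)
    have h2 := qFun_lt_one ((S.sigma1 q k * S.alphaHat q k +
      (S.mu1 q k - S.mu0 q k) * √(S.f q * S.tauMin q)) / S.sigma0 q k)
    rw [h0]
    exact Real.log_nonpos (by linarith) (by linarith)
  have hden : ∀ k, 0 < S.noise q k + ∑ r ∈ Finset.univ.erase q, S.gain q r k * S.pMax r k :=
    fun k => (interf_pos hx k).trans_le (interf_le hx k)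
  -- Opponents transmitting at their masks are the worst case for the rate of the reference powers.
  have href : Real.log (∑ k, Real.log (1 + pRef q k /
      (S.noise q k + ∑ r ∈ Finset.univ.erase q, S.gain q r k * S.pMax r k))) ≤
      Real.log (S.sumRate q (Function.update x q (y.withPow (pRef q)))) := by
    rw [sumRate_update]
    refine Real.log_le_log ?_ (Finset.sum_le_sum fun k _ => ?_)
    · obtain ⟨k, hk⟩ := Function.ne_iff.1 hp.2.1
      refine Finset.sum_pos' (fun k _ => Real.log_nonneg ?_)
        ⟨k, Finset.mem_univ k, Real.log_pos ?_⟩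
      · have := div_nonneg (hp.1.2 k).1 (hden k).le
        linarith
      · have := div_pos (lt_of_le_of_ne (hp.1.2 k).1 (Ne.symm hk)) (hden k)
        linarith
    · have h1 := hden k
      have h2 := interf_pos hx k
      have h3 := interf_le hx k
      have h4 := (hp.1.2 k).1
      have h5 : (y.withPow (pRef q)).pow k = pRef q k := rfl
      rw [h5]
      refine Real.log_le_log (by positivity) ?_
      gcongr
  have hR : 0 < S.sumRate q (Function.update x q y) :=
    sumRate_pos (update_mem hx hy) (by simpa using hy0)
  have heta : S.etaRef t q (pRef q) ≤ Real.log (S.sumRate q (Function.update x q y)) := by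
    unfold etaRef
    linarith
  have hexp := (Real.exp_le_exp.2 heta).trans_eq (Real.exp_log hR)
  have hmin : 0 < ⨅ k, S.noise q k := by
    obtain ⟨k, hk⟩ := exists_eq_ciInf_of_finite (f := S.noise q)
    rw [← hk]
    exact S.noise_pos q k
  have hle := hexp.trans (sumRate_le (update_mem hx hy) q)
  rw [le_div_iff₀ hmin, mul_comm] at hle
  simpa using hle

/-! ### First-order conditions and the bound on the multiplier -/

lemma update_add_smul (x : Profile Q N) (q : Fin Q) (y z : Strategy N) (s : ℝ) :
    Function.update x q y + s • (Pi.single q (z - y) : Profile Q N) =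
      Function.update x q ((1 - s) • y + s • z) := by
  funext r
  by_cases hr : r = q
  · subst hr
    simp only [Pi.add_apply, Pi.smul_apply, Function.update_self, Pi.single_eq_same]
    module
  · simp [hr]

lemma update_add_single (x : Profile Q N) (q : Fin Q) (y z : Strategy N) :
    Function.update x q y + (Pi.single q (z - y) : Profile Q N) = Function.update x q z := by
  have := update_add_smul x q y z 1
  simpa using this

lemma pow_combo_ne_zero {y z : Strategy N} (hy : y ∈ S.convSet q) (hz : z ∈ S.convSet q)
    (hy0 : y.pow ≠ 0) {a b : ℝ} (ha : 0 < a) (hb : 0 ≤ b) : (a • y + b • z).pow ≠ 0 := by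
  obtain ⟨k, hk⟩ := Function.ne_iff.1 hy0
  refine Function.ne_iff.2 ⟨k, ?_⟩
  have h1 : 0 < y.pow k := lt_of_le_of_ne (S.pow_nonneg hy k) (Ne.symm hk)
  have h2 := S.pow_nonneg hz k
  have h3 : (a • y + b • z).pow k = a * y.pow k + b * z.pow k := rfl
  rw [h3, Pi.zero_apply]
  positivity

/-- The cost does not decrease at first order in a feasible direction. -/
lemma IsOptimal.fderiv_cost_nonneg [NeZero N] {y : Strategy N} (h : S.IsOptimal c price q x y)
    (hx : ∀ r, r ≠ q → x r ∈ S.convSet r) (hp : S.IsRefPower q p) {z : Strategy N}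
    (hz : z ∈ S.convSet q)
    (hdir : S.locInt q y < 0 ∨ fderiv ℝ (fun x : Profile Q N => S.locInt q (x q))
      (Function.update x q y) (Pi.single q (z - y)) < 0) :
    0 ≤ fderiv ℝ (S.cost c price q) (Function.update x q y) (Pi.single q (z - y)) := by
  have hX := update_mem hx h.1.1
  have hy0 := h.pow_ne_zero hx hp
  have hF := contDiffAt_cost hX (q := q) (by simpa using hy0) c price
  have hg := contDiffAt_locInt (hX q)
  have hFd := hasDerivAt_line (x := Function.update x q y) (d := Pi.single q (z - y)) (s := 0)
    (F := S.cost c price q) (by simpa using hF.differentiableAt (by norm_num))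
  have hgd := hasDerivAt_line (x := Function.update x q y) (d := Pi.single q (z - y)) (s := 0)
    (F := fun x : Profile Q N => S.locInt q (x q))
    (by simpa using hg.differentiableAt (by norm_num))
  simp only [update_add_smul, Function.update_self] at hFd hgd
  simp only [zero_smul, sub_zero, one_smul, add_zero] at hFd hgd
  -- The strategy set is not convex, so only short steps are feasible: by continuity if the
  -- constraint is inactive, by its negative slope otherwise.
  have hfeas : ∀ᶠ s : ℝ in 𝓝[>] 0, S.locInt q ((1 - s) • y + s • z) ≤ 0 := by
    rcases hdir with hdir | hdir
    · have := hgd.continuousAt.tendsto.eventually_lt_const (u := 0) (by simpa using hdir)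
      filter_upwards [nhdsWithin_le_nhds this] with s hs using hs.le
    · have := hgd.tendsto_slope_zero_right.eventually (gt_mem_nhds hdir)
      filter_upwards [this, self_mem_nhdsWithin] with s hs hs0
      have hs1 : 0 < s⁻¹ := inv_pos.2 hs0
      simp only [zero_add, smul_eq_mul, sub_zero, one_smul, zero_smul, add_zero] at hs
      have h2 := neg_of_mul_neg_right hs hs1.le
      linarith [h.1.2]
  have hl := hFd.tendsto_slope_zero_right
  refine ge_of_tendsto hl ?_
  filter_upwards [hfeas, Ioo_mem_nhdsGT (zero_lt_one (α := ℝ))] with s hs hs1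
  simp only [zero_add, sub_zero, one_smul, zero_smul, add_zero, smul_eq_mul]
  refine mul_nonneg (inv_nonneg.2 hs1.1.le) (sub_nonneg.2 ?_)
  refine h.cost_le hx hp ⟨S.convex_convSet q h.1.1 hz (sub_nonneg.2 hs1.2.le) hs1.1.le (by ring),
    hs⟩ (pow_combo_ne_zero h.1.1 hz hy0 (sub_pos.2 hs1.2) hs1.1.le)

lemma zero_mem_powerSet (q : Fin Q) : (0 : Fin N → ℝ) ∈ S.powerSet q :=
  ⟨by simpa using (S.budget_pos q).le, fun k => ⟨le_rfl, (S.pMax_pos q k).le⟩⟩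

lemma combo_withPow_zero (y : Strategy N) (s : ℝ) :
    (1 - s) • y + s • y.withPow 0 = y.withPow ((1 - s) • y.pow) := by
  funext i
  rcases i with i | k | i
  · change (1 - s) * y.sens + s * y.sens = y.sens
    ring
  · change (1 - s) * y.pow k + s * 0 = (1 - s) * y.pow k
    ring
  · change (1 - s) * y.fa + s * y.fa = y.fa
    ring

/-- Interference is linear in the powers when the other coordinates are fixed. At an active
constraint the value is `-locMax < 0`, which acts as a constraint qualification. -/
lemma fderiv_locInt_withPow_zero (hx : ∀ r, r ≠ q → x r ∈ S.convSet r) {y : Strategy N}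
    (hy : y ∈ S.convSet q) :
    fderiv ℝ (fun x : Profile Q N => S.locInt q (x q)) (Function.update x q y)
      (Pi.single q (y.withPow 0 - y)) = -(S.locInt q y + S.locMax q) := by
  have hg := contDiffAt_locInt (update_mem hx hy q)
  have hgd := hasDerivAt_line (x := Function.update x q y) (d := Pi.single q (y.withPow 0 - y))
    (s := 0) (F := fun x : Profile Q N => S.locInt q (x q))
    (by simpa using hg.differentiableAt (by norm_num))
  simp only [update_add_smul, Function.update_self, combo_withPow_zero,
    locInt_withPow_smul] at hgd
  have h2 : HasDerivAt (fun s : ℝ => (1 - s) * (S.locInt q y + S.locMax q) - S.locMax q)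
      (-(S.locInt q y + S.locMax q)) 0 := by
    have := (((hasDerivAt_id (0 : ℝ)).const_sub 1).mul_const
      (S.locInt q y + S.locMax q)).sub_const (S.locMax q)
    simpa using this
  have h3 := hgd.unique h2
  simpa [Strategy.withPow_pow] using h3

/-- Scaling the powers by `1 - s` scales the rate by at least `1 - s`, so the logarithm of the rate
loses at most `-log (1 - s)`, of slope 1 at 0; the priced interference does not increase. -/
lemma fderiv_cost_withPow_zero_le (hprice : 0 ≤ price) (hx : ∀ r, r ≠ q → x r ∈ S.convSet r)
    {y : Strategy N} (hy : y ∈ S.convSet q) (hy0 : y.pow ≠ 0) :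
    fderiv ℝ (S.cost c price q) (Function.update x q y) (Pi.single q (y.withPow 0 - y)) ≤ 1 := by
  have hX := update_mem hx hy
  have hF := contDiffAt_cost hX (q := q) (by simpa using hy0) c price
  have hFd := hasDerivAt_line (x := Function.update x q y) (d := Pi.single q (y.withPow 0 - y))
    (s := 0) (F := S.cost c price q) (by simpa using hF.differentiableAt (by norm_num))
  simp only [update_add_smul, combo_withPow_zero] at hFd
  have h2 : HasDerivAt (fun s : ℝ => -Real.log (1 - s)) 1 0 := by
    have := (((hasDerivAt_id (0 : ℝ)).const_sub 1).log (by simp)).neg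
    exact this.congr_deriv (by simp)
  have hl := hFd.tendsto_slope_zero_right
  have hl2 := h2.tendsto_slope_zero_right
  simp only [sub_zero, one_smul, Strategy.withPow_pow] at hl
  refine le_of_tendsto_of_tendsto hl hl2 ?_
  filter_upwards [Ioo_mem_nhdsGT (zero_lt_one (α := ℝ))] with s hs
  have hs1 : 0 < 1 - s := sub_pos.2 hs.2
  simp only [zero_add, smul_eq_mul, sub_zero, Real.log_one, neg_zero]
  refine mul_le_mul_of_nonneg_left ?_ (inv_nonneg.2 hs.1.le)
  have hpow : (1 - s) • y.pow ∈ S.powerSet q := by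
    have := S.convex_powerSet q hy.2.2.2.1 (zero_mem_powerSet q) hs1.le hs.1.le (by ring)
    simpa using this
  have hpow0 : (1 - s) • y.pow ≠ 0 := smul_ne_zero hs1.ne' hy0
  rw [cost_withPow_sub hx hy hy0 hpow hpow0, locInt_withPow_smul]
  have hI : 0 ≤ S.locInt q y + S.locMax q := by
    rw [locInt, sub_add_cancel]
    exact Finset.sum_nonneg fun k _ => mul_nonneg
      (mul_nonneg (S.missProb_pos q k y).le (S.w_pos q k).le) (S.pow_nonneg hy k)
  have hterm : price * ((1 - s) * (S.locInt q y + S.locMax q) - S.locMax q - S.locInt q y) ≤ 0 :=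
    mul_nonpos_of_nonneg_of_nonpos hprice (by nlinarith [mul_nonneg hs.1.le hI])
  have hR : (1 - s) * S.sumRate q (Function.update x q y) ≤
      S.sumRate q (Function.update x q (y.withPow ((1 - s) • y.pow))) := by
    rw [sumRate_update, sumRate_update, Finset.mul_sum]
    refine Finset.sum_le_sum fun k _ => ?_
    have h3 := interf_pos hx k
    have h4 : 0 ≤ y.pow k / S.interf q k x := div_nonneg (S.pow_nonneg hy k) h3.le
    have h5 : (y.withPow ((1 - s) • y.pow)).pow k / S.interf q k x =
        (1 - s) * (y.pow k / S.interf q k x) := by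
      change (1 - s) * y.pow k / S.interf q k x = _
      ring
    rw [h5, ← Real.log_rpow (by linarith)]
    refine Real.log_le_log (by positivity) ?_
    -- Bernoulli's inequality with exponent `1 - s` in `[0, 1]`.
    exact rpow_one_add_le_one_add_mul_self (by linarith) hs1.le (by linarith [hs.1])
  have hRpos : 0 < S.sumRate q (Function.update x q y) := sumRate_pos hX (by simpa using hy0)
  have h6 := Real.log_le_log (mul_pos hs1 hRpos) hR
  rw [Real.log_mul hs1.ne' hRpos.ne'] at h6
  linarith

/-- The summand of `q` alone suffices: its numerator is at least `1 / locMax`, and its denominator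
is at most `noise / (noise + interference) ≤ 1` by `log (1 + u) ≤ u`. -/
lemma one_div_locMax_le_multMax [NeZero N] [NeZero Q] (S : System Q N) (q : Fin Q) :
    1 / S.locMax q ≤ S.multMax := by
  have hmin : 0 < ⨅ r, min (S.locMax r) (⨅ k, S.pMax r k) := by
    obtain ⟨r, hr⟩ := exists_eq_ciInf_of_finite (f := fun r => min (S.locMax r) (⨅ k, S.pMax r k))
    rw [← hr]
    obtain ⟨k, hk⟩ := exists_eq_ciInf_of_finite (f := S.pMax r)
    rw [← hk]
    exact lt_min (S.locMax_pos r) (S.pMax_pos r k)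
  have hmin_le : ⨅ r, min (S.locMax r) (⨅ k, S.pMax r k) ≤ S.locMax q :=
    (ciInf_le (Set.finite_range _).bddBelow q).trans (min_le_left _ _)
  set D : Fin Q → ℝ := fun q => (⨅ k, 1 / S.pMax q k * Real.log (1 + S.pMax q k /
        (S.noise q k + ∑ r ∈ Finset.univ.erase q, S.gain q r k * S.pMax r k))) *
      ⨅ k, S.noise q k with hD
  have hden : ∀ q k, S.noise q k ≤
      S.noise q k + ∑ r ∈ Finset.univ.erase q, S.gain q r k * S.pMax r k := fun q k =>
    le_add_of_nonneg_right (Finset.sum_nonneg fun r _ =>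
      mul_nonneg (S.gain_nonneg q r k) (S.pMax_pos r k).le)
  have hDpos : ∀ q, 0 < D q := by
    intro q
    refine mul_pos ?_ ?_
    · obtain ⟨k, hk⟩ := exists_eq_ciInf_of_finite (f := fun k => 1 / S.pMax q k *
        Real.log (1 + S.pMax q k /
        (S.noise q k + ∑ r ∈ Finset.univ.erase q, S.gain q r k * S.pMax r k)))
      rw [← hk]
      have h1 := S.pMax_pos q k
      have h2 := div_pos h1 ((S.noise_pos q k).trans_le (hden q k))
      exact mul_pos (one_div_pos.2 h1) (Real.log_pos (by linarith))
    · obtain ⟨k, hk⟩ := exists_eq_ciInf_of_finite (f := S.noise q)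
      rw [← hk]
      exact S.noise_pos q k
  have hD1 : D q ≤ 1 := by
    obtain ⟨k, hk⟩ := exists_eq_ciInf_of_finite (f := S.noise q)
    have hn := S.noise_pos q k
    have h1 := S.pMax_pos q k
    have hd := hn.trans_le (hden q k)
    have h2 := div_pos h1 hd
    simp only [hD, ← hk]
    calc _ ≤ (1 / S.pMax q k * Real.log (1 + S.pMax q k /
          (S.noise q k + ∑ r ∈ Finset.univ.erase q, S.gain q r k * S.pMax r k))) *
          S.noise q k := by
          gcongr
          exact ciInf_le (Set.finite_range _).bddBelow k
      _ ≤ (1 / S.pMax q k * (S.pMax q k / (S.noise q k +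
          ∑ r ∈ Finset.univ.erase q, S.gain q r k * S.pMax r k))) * S.noise q k := by
          gcongr
          have := Real.log_le_sub_one_of_pos (x := 1 + S.pMax q k /
            (S.noise q k + ∑ r ∈ Finset.univ.erase q, S.gain q r k * S.pMax r k)) (by linarith)
          linarith
      _ = S.noise q k / (S.noise q k +
          ∑ r ∈ Finset.univ.erase q, S.gain q r k * S.pMax r k) := by
          field_simp
      _ ≤ 1 := (div_le_one hd).2 (hden q k)
  have hle : 1 / S.locMax q ≤ (1 / ⨅ r, min (S.locMax r) (⨅ k, S.pMax r k)) / D q := by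
    have h1 : 1 / S.locMax q ≤ 1 / ⨅ r, min (S.locMax r) (⨅ k, S.pMax r k) :=
      one_div_le_one_div_of_le hmin hmin_le
    refine h1.trans ?_
    rw [le_div_iff₀ (hDpos q)]
    exact mul_le_of_le_one_right (one_div_pos.2 hmin).le hD1
  exact hle.trans (Finset.single_le_sum (f := fun q =>
    (1 / ⨅ r, min (S.locMax r) (⨅ k, S.pMax r k)) / D q)
    (fun q _ => (div_pos (one_div_pos.2 hmin) (hDpos q)).le) (Finset.mem_univ q))

/-- First-order optimality conditions, with a bound on the multiplier. -/
lemma IsOptimal.exists_multiplier [NeZero N] [NeZero Q] {y : Strategy N}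
    (h : S.IsOptimal c price q x y) (hprice : 0 ≤ price)
    (hx : ∀ r, r ≠ q → x r ∈ S.convSet r) (hp : S.IsRefPower q p) :
    ∃ m ∈ Icc 0 S.multMax, m * S.locInt q y = 0 ∧ ∀ z ∈ S.convSet q,
      0 ≤ fderiv ℝ (S.cost c price q) (Function.update x q y) (Pi.single q (z - y)) +
        m * fderiv ℝ (fun x : Profile Q N => S.locInt q (x q)) (Function.update x q y)
          (Pi.single q (z - y)) := by
  have hpos := one_div_pos.2 (S.locMax_pos q)
  rcases h.1.2.lt_or_eq with hlt | heq
  · refine ⟨0, ⟨le_rfl, hpos.le.trans (one_div_locMax_le_multMax S q)⟩, zero_mul _,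
      fun z hz => ?_⟩
    rw [zero_mul, add_zero]
    exact h.fderiv_cost_nonneg hx hp hz (Or.inl hlt)
  · have hg0 := fderiv_locInt_withPow_zero hx h.1.1
    rw [heq, zero_add] at hg0
    have hmem := withPow_mem h.1.1 (zero_mem_powerSet q)
    obtain ⟨m, hm, hm'⟩ := exists_multiplier_of_convex (S.convex_convSet q) (y := y)
      ((fderiv ℝ (S.cost c price q) (Function.update x q y)).toLinearMap ∘ₗ
        LinearMap.single ℝ (fun _ : Fin Q => Strategy N) q)
      ((fderiv ℝ (fun x : Profile Q N => S.locInt q (x q))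
        (Function.update x q y)).toLinearMap ∘ₗ
        LinearMap.single ℝ (fun _ : Fin Q => Strategy N) q) hmem
      (by
        change fderiv ℝ (fun x : Profile Q N => S.locInt q (x q)) (Function.update x q y)
          (Pi.single q (y.withPow 0 - y)) < 0
        rw [hg0]
        linarith [S.locMax_pos q])
      fun z hz hgz => h.fderiv_cost_nonneg hx hp hz (Or.inr hgz)
    refine ⟨m, ⟨hm, le_trans ?_ (one_div_locMax_le_multMax S q)⟩, by rw [heq, mul_zero],
      fun z hz => hm' z hz⟩
    have h1 : 0 ≤ fderiv ℝ (S.cost c price q) (Function.update x q y)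
        (Pi.single q (y.withPow 0 - y)) + m * fderiv ℝ (fun x : Profile Q N => S.locInt q (x q))
          (Function.update x q y) (Pi.single q (y.withPow 0 - y)) := hm' _ hmem
    -- In the direction of zero power the optimality condition reads `0 ≤ 1 - m * locMax`, after
    -- bounding the cost derivative by 1.
    have h2 := fderiv_cost_withPow_zero_le (c := c) hprice hx h.1.1 (h.pow_ne_zero hx hp)
    rw [hg0] at h1
    rw [le_div_iff₀ (S.locMax_pos q)]
    linarith

end System

end CognitiveRadio

namespace CognitiveRadio

open Set Filter Topology

namespace System

variable {Q N : ℕ} {S : System Q N} {q r : Fin Q} {x : Profile Q N} {c t price : ℝ}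
  {p : Fin N → ℝ} {pRef : Fin Q → Fin N → ℝ}

/-! ### The norm of one block -/

/-- The second block of a strategy, with its Euclidean norm. -/
noncomputable def tailNorm (d : Strategy N) : ℝ :=
  ‖WithLp.toLp 2 (fun j : Fin N ⊕ Unit => d (Sum.inr j))‖

lemma tailNorm_nonneg (d : Strategy N) : 0 ≤ tailNorm d := norm_nonneg _

/-- The norm of the block of player `q` that appears in `blockNorm`. -/
noncomputable def stratNorm (S : System Q N) (c t : ℝ) (pRef : Fin Q → Fin N → ℝ) (q : Fin Q)
    (d : Strategy N) : ℝ :=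
  ‖WithLp.toLp 2 ((S.Dmat c t pRef q).mulVec ![|d (Sum.inl ())|, tailNorm d])‖

lemma stratNorm_nonneg (d : Strategy N) : 0 ≤ S.stratNorm c t pRef q d := norm_nonneg _

lemma rho_nonneg : 0 ≤ S.rho t pRef q := le_max_left _ _

lemma stratNorm_sq (hc : 0 ≤ c) (d : Strategy N) :
    S.stratNorm c t pRef q d ^ 2 =
      (S.rho t pRef q + c * ((1 - 1 / (Q : ℝ)) / √(S.f q)) ^ 2) * d (Sum.inl ()) ^ 2 +
        S.rho t pRef q * tailNorm d ^ 2 := by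
  have h : 0 ≤ S.rho t pRef q := rho_nonneg
  rw [stratNorm, EuclideanSpace.real_norm_sq_eq, Fin.sum_univ_two]
  simp only [Dmat, Matrix.mulVec_diagonal, Matrix.cons_val_zero, Matrix.cons_val_one, mul_pow,
    sq_abs]
  rw [Real.sq_sqrt (by positivity), Real.sq_sqrt h]

lemma rho_pos (hD : IsUnit (S.Dmat c t pRef q)) : 0 < S.rho t pRef q := by
  rw [Matrix.isUnit_iff_isUnit_det, Dmat, Matrix.det_diagonal, Fin.prod_univ_two,
    isUnit_iff_ne_zero] at hD
  have h : √(S.rho t pRef q) ≠ 0 := right_ne_zero_of_mul hD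
  exact Real.sqrt_pos.1 (lt_of_le_of_ne (Real.sqrt_nonneg _) h.symm)

lemma eq_zero_of_stratNorm (hc : 0 ≤ c) (hρ : 0 < S.rho t pRef q) {d : Strategy N}
    (h : S.stratNorm c t pRef q d = 0) : d = 0 := by
  have h1 := stratNorm_sq (S := S) (q := q) (t := t) (pRef := pRef) hc d
  rw [h] at h1
  have h2 : 0 ≤ c * ((1 - 1 / (Q : ℝ)) / √(S.f q)) ^ 2 := by positivity
  have h3 := sq_nonneg (d (Sum.inl ()))
  have h4 := sq_nonneg (tailNorm d)
  have h5 : d (Sum.inl ()) ^ 2 = 0 := by nlinarith [mul_nonneg h2 h3, mul_nonneg hρ.le h4]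
  have h6 : tailNorm d ^ 2 = 0 := by nlinarith [mul_nonneg h2 h3, mul_nonneg hρ.le h3]
  have h7 : tailNorm d = 0 := by simpa using h6
  rw [tailNorm, norm_eq_zero] at h7
  funext i
  rcases i with ⟨⟩ | j
  · simpa using h5
  · exact congrFun (congrArg WithLp.ofLp h7) j

/-! ### The restricted sets -/

lemma convex_convSetLow [NeZero N] : Convex ℝ (S.convSetLow t pRef q) := by
  rintro y ⟨hy1, hy2⟩ z ⟨hz1, hz2⟩ a b ha hb hab
  refine ⟨S.convex_convSet q hy1 hz1 ha hb hab, ?_⟩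
  have h : ∑ k, (a • y + b • z).pow k = a * ∑ k, y.pow k + b * ∑ k, z.pow k := by
    rw [Finset.mul_sum, Finset.mul_sum, ← Finset.sum_add_distrib]
    rfl
  rw [h]
  set M := (⨅ k, S.noise q k) * Real.exp (S.etaRef t q (pRef q))
  calc M = a * M + b * M := by rw [← add_mul, hab, one_mul]
    _ ≤ _ := by gcongr

/-- The power threshold is strictly positive, so payoffs are C² on all of `profilesLow`. -/
lemma pow_ne_zero_of_mem_low [NeZero N] {y : Strategy N} (hy : y ∈ S.convSetLow t pRef q) :
    y.pow ≠ 0 := by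
  intro h0
  have h := hy.2
  simp only [h0, Pi.zero_apply, Finset.sum_const_zero] at h
  obtain ⟨k, hk⟩ := exists_eq_ciInf_of_finite (f := S.noise q)
  rw [← hk] at h
  have := mul_pos (S.noise_pos q k) (Real.exp_pos (S.etaRef t q (pRef q)))
  linarith

lemma profilesLow_subset : S.profilesLow t pRef q ⊆ S.convProd := by
  intro x hx r
  by_cases hr : r = q
  · subst hr; exact hx.1.1
  · exact hx.2 r hr

lemma update_mem_profilesLow (hx : ∀ r, r ≠ q → x r ∈ S.convSet r) {y : Strategy N}
    (hy : y ∈ S.convSetLow t pRef q) : Function.update x q y ∈ S.profilesLow t pRef q :=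
  ⟨by simpa using hy, fun r hr => by simpa [hr] using hx r hr⟩

lemma isCompact_profilesLow [NeZero N] : IsCompact (S.profilesLow t pRef q) := by
  have hlow : IsCompact (S.convSetLow t pRef q) := by
    have hcl : IsClosed {y : Strategy N |
        (⨅ k, S.noise q k) * Real.exp (S.etaRef t q (pRef q)) ≤ ∑ k, y.pow k} :=
      isClosed_le continuous_const (continuous_finsetSum _ fun k _ => continuous_pow k)
    exact (S.isCompact_convSet q).inter_right hcl
  have h : S.profilesLow t pRef q = Set.pi univ fun r =>
      if r = q then S.convSetLow t pRef q else S.convSet r := by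
    ext x
    simp only [mem_univ_pi]
    constructor
    · rintro ⟨h1, h2⟩ r
      by_cases hr : r = q
      · subst hr; simpa using h1
      · simpa [hr] using h2 r hr
    · intro h
      exact ⟨by simpa using h q, fun r hr => by simpa [hr] using h r⟩
  rw [h]
  refine isCompact_univ_pi fun r => ?_
  by_cases hr : r = q
  · simpa [hr] using hlow
  · simpa [hr] using S.isCompact_convSet r

/-! ### Strong optimality -/

lemma rho_mul_le (hρ : 0 < S.rho t pRef q) [NeZero N] {x : Profile Q N}
    (hx : x ∈ S.profilesLow t pRef q) {m : ℝ} (hm : m ∈ Icc 0 S.multMax) (hprice : 0 ≤ price)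
    (hpt : price ≤ t) (d : Strategy N) :
    S.rho t pRef q * (d (Sum.inl ()) ^ 2 + tailNorm d ^ 2) ≤
      fderiv ℝ (fderiv ℝ (S.lagrangian 0 price m q)) x (Pi.single q d) (Pi.single q d) := by
  have hC := contDiffAt_lagrangian (profilesLow_subset hx) (pow_ne_zero_of_mem_low hx.1) 0 price m
  rw [fderiv_fderiv_single hC]
  refine le_trans ?_ (leastEig_block_mul_le (hess_transpose hC q q) d)
  refine mul_le_mul_of_nonneg_right ?_ (by positivity)
  have hpos := hρ
  unfold rho at hpos ⊢
  set A : Set ℝ := {e : ℝ | ∃ x ∈ S.profilesLow t pRef q, ∃ m ∈ Set.Icc 0 S.multMax,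
    ∃ price ∈ Set.Icc 0 t, e = leastEig (S.Bmat price m q x)} with hA
  have hA0 : 0 < sInf A := (lt_max_iff.1 hpos).resolve_left (lt_irrefl 0)
  -- The infimum of a set unbounded below is 0 by convention; positivity of `rho` excludes this
  -- case, so the infimum is a true lower bound.
  have hbdd : BddBelow A := by
    by_contra hn
    rw [Real.sInf_of_not_bddBelow hn] at hA0
    exact lt_irrefl 0 hA0
  rw [max_eq_right hA0.le]
  exact csInf_le hbdd ⟨x, hx, m, hm, price, ⟨hprice, hpt⟩, rfl⟩

/-- The deviation of the normalized sensing time of player `q` from the average. -/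
noncomputable def sensDev (S : System Q N) (q : Fin Q) (x : Profile Q N) : ℝ :=
  (x q).sens / √(S.f q) - 1 / (Q : ℝ) * ∑ r, (x r).sens / √(S.f r)

lemma sensDev_add_smul (x : Profile Q N) (d : Strategy N) (s : ℝ) :
    S.sensDev q (x + s • (Pi.single q d : Profile Q N)) =
      S.sensDev q x + s * ((1 - 1 / (Q : ℝ)) / √(S.f q) * d (Sum.inl ())) := by
  have h1 : ∀ r, ((x + s • (Pi.single q d : Profile Q N)) r).sens / √(S.f r) =
      (x r).sens / √(S.f r) + if r = q then s * (d (Sum.inl ()) / √(S.f q)) else 0 := by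
    intro r
    by_cases hr : r = q
    · subst hr
      simp only [Strategy.sens, Pi.add_apply, Pi.smul_apply, Pi.single_eq_same, smul_eq_mul,
        if_true]
      ring
    · simp [Strategy.sens, hr]
  unfold sensDev
  simp only [h1, Finset.sum_add_distrib, Finset.sum_ite_eq', Finset.mem_univ, if_true]
  ring

/-- The penalty is quadratic, so its second-order expansion is exact. Moving the own sensing time
also moves the average, whence the factor `1 - 1 / Q`. -/
lemma penalty_add_single (x : Profile Q N) (d : Strategy N) :
    S.penalty c q (x + Pi.single q d) = S.penalty c q x +
      fderiv ℝ (S.penalty c q) x (Pi.single q d) +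
      c * ((1 - 1 / (Q : ℝ)) / √(S.f q)) ^ 2 * d (Sum.inl ()) ^ 2 / 2 := by
  have hpen : ∀ x, S.penalty c q x = c / 2 * S.sensDev q x ^ 2 := fun _ => rfl
  have h1 := hasDerivAt_line (F := S.penalty c q) (x := x) (d := Pi.single q d) (s := 0)
    ((contDiff_penalty c q).contDiffAt.differentiableAt (by norm_num))
  simp only [hpen, sensDev_add_smul, zero_smul, add_zero] at h1
  set e := (1 - 1 / (Q : ℝ)) / √(S.f q) with he
  have h2 : HasDerivAt (fun s : ℝ => c / 2 * (S.sensDev q x + s * (e * d (Sum.inl ()))) ^ 2)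
      (c * S.sensDev q x * (e * d (Sum.inl ()))) 0 := by
    have := ((((hasDerivAt_id (0 : ℝ)).mul_const (e * d (Sum.inl ()))).const_add
      (S.sensDev q x)).pow 2).const_mul (c / 2)
    refine this.congr_deriv ?_
    simp
    ring
  have h3 := h1.unique h2
  have h4 := sensDev_add_smul (S := S) (q := q) x d 1
  rw [one_smul, one_mul] at h4
  rw [h3, hpen, hpen, h4]
  ring

/-- The penalty is split off because `rho` is defined with `c = 0`; its curvature then adds to `rho`
in the first entry of `D_q`. -/
lemma cost_add_locInt (m : ℝ) (x : Profile Q N) :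
    S.cost c price q x + m * S.locInt q (x q) =
      S.lagrangian 0 price m q x + S.penalty c q x := by
  have : S.theta 0 q x = S.theta c q x + S.penalty c q x := by
    rw [theta_eq, theta_eq]
    simp [penalty]
  rw [cost, lagrangian, this]
  ring

/-- Quadratic growth of the cost around an optimal strategy. -/
lemma IsOptimal.cost_add_sq_le [NeZero N] [NeZero Q] (hc : 0 ≤ c) (hρ : 0 < S.rho t pRef q)
    {y : Strategy N} (h : S.IsOptimal c price q x y) (hprice : 0 ≤ price) (hpt : price ≤ t)
    (hx : ∀ r, r ≠ q → x r ∈ S.convSet r) (hp : S.IsRefPower q (pRef q)) {z : Strategy N}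
    (hz : z ∈ S.convSetLow t pRef q) (hz' : S.locInt q z ≤ 0) :
    S.cost c price q (Function.update x q y) + S.stratNorm c t pRef q (z - y) ^ 2 / 2 ≤
      S.cost c price q (Function.update x q z) := by
  obtain ⟨m, hm, hm0, hm1⟩ := h.exists_multiplier hprice hx hp
  have hylow := h.mem_convSetLow hprice hpt hx hp
  set X := Function.update x q y with hX
  set d : Profile Q N := Pi.single q (z - y) with hd
  have hXmem : X ∈ S.convProd := update_mem hx h.1.1
  have hXpow : (X q).pow ≠ 0 := by simpa [hX] using h.pow_ne_zero hx hp
  -- Points of the segment may violate the interference constraint; membership in the convex set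
  -- `convSetLow` is all that the curvature bound needs.
  have hline : ∀ s ∈ Icc (0 : ℝ) 1, X + s • d ∈ S.profilesLow t pRef q := by
    intro s hs
    rw [hX, hd, update_add_smul]
    exact update_mem_profilesLow hx
      (convex_convSetLow hylow hz (sub_nonneg.2 hs.2) hs.1 (by ring))
  have hquad := quadratic_lower_bound (F := S.lagrangian 0 price m q) (x := X) (d := d)
    (m := S.rho t pRef q * ((z - y) (Sum.inl ()) ^ 2 + tailNorm (z - y) ^ 2))
    (fun s hs => contDiffAt_lagrangian (profilesLow_subset (hline s hs))
      (pow_ne_zero_of_mem_low (hline s hs).1) 0 price m)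
    (fun s hs => rho_mul_le hρ (hline s hs) hm hprice hpt (z - y))
  have hpen := penalty_add_single (S := S) (c := c) (q := q) X (z - y)
  have hder : fderiv ℝ (S.cost c price q) X d +
      m * fderiv ℝ (fun x : Profile Q N => S.locInt q (x q)) X d =
      fderiv ℝ (S.lagrangian 0 price m q) X d + fderiv ℝ (S.penalty c q) X d := by
    have d1 := ((contDiffAt_cost hXmem hXpow c price).differentiableAt (by norm_num)).hasFDerivAt
    have d2 := ((contDiffAt_locInt (hXmem q)).differentiableAt (by norm_num)).hasFDerivAt
    have d3 := ((contDiffAt_lagrangian hXmem hXpow 0 price m).differentiableAt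
      (by norm_num)).hasFDerivAt
    have d4 := ((contDiff_penalty (S := S) c q).contDiffAt (x := X)
      |>.differentiableAt (by norm_num)).hasFDerivAt
    have e1 := d1.add (d2.const_mul m)
    have e2 := d3.add d4
    have hfun : (S.cost c price q + fun x => m * S.locInt q (x q)) =
        S.lagrangian 0 price m q + S.penalty c q := funext fun x => cost_add_locInt m x
    rw [hfun] at e1
    simpa using congrArg (fun L : Profile Q N →L[ℝ] ℝ => L d) (e1.unique e2)
  have hfirst := hm1 z hz.1
  have hXd : X + d = Function.update x q z := update_add_single x q y z
  have e1 := cost_add_locInt (S := S) (c := c) (price := price) (q := q) m X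
  have e2 := cost_add_locInt (S := S) (c := c) (price := price) (q := q) m (X + d)
  have hXq : X q = y := by simp [hX]
  have hXdq : (X + d) q = z := by rw [hXd, Function.update_self]
  rw [hXq, hm0] at e1
  rw [hXdq] at e2
  -- Complementarity at `y` and feasibility of `z` convert growth of the Lagrangian into growth of
  -- the cost.
  have hmz : m * S.locInt q z ≤ 0 := mul_nonpos_of_nonneg_of_nonpos hm.1 hz'
  rw [← hXd, stratNorm_sq hc]
  linarith

lemma IsOptimal.unique [NeZero N] [NeZero Q] (hc : 0 ≤ c) (hρ : 0 < S.rho t pRef q)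
    {y z : Strategy N} (hy : S.IsOptimal c price q x y) (hz : S.IsOptimal c price q x z)
    (hprice : 0 ≤ price) (hpt : price ≤ t)
    (hx : ∀ r, r ≠ q → x r ∈ S.convSet r) (hp : S.IsRefPower q (pRef q)) : z = y := by
  have h1 := hy.cost_add_sq_le hc hρ hprice hpt hx hp (hz.mem_convSetLow hprice hpt hx hp) hz.1.2
  have h2 := hz.cost_le hx hp hy.1 (hy.pow_ne_zero hx hp)
  have h3 : S.stratNorm c t pRef q (z - y) ^ 2 = 0 := by
    nlinarith [sq_nonneg (S.stratNorm c t pRef q (z - y))]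
  exact sub_eq_zero.1 (eq_zero_of_stratNorm hc hρ (by simpa using h3))

/-! ### Mixed second derivatives of the payoffs -/

lemma sumRate_update_coord (x : Profile Q N) (r : Fin Q) (i : Coord N) (s : ℝ)
    (hi : ∀ k, i ≠ Sum.inr (Sum.inl k)) :
    S.sumRate q (Function.update x r (Function.update (x r) i s)) = S.sumRate q x := by
  have h : ∀ r' k, (Function.update x r (Function.update (x r) i s) r').pow k =
      (x r').pow k := by
    intro r' k
    by_cases hr : r' = r
    · subst hr
      simp only [Function.update_self, Strategy.pow]
      rw [Function.update_of_ne (hi k).symm]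
    · simp [hr]
  simp only [sumRate, rate, h]

lemma penalty_update_coord (x : Profile Q N) (r : Fin Q) (j : Fin N ⊕ Unit) (s : ℝ) :
    S.penalty c q (Function.update x r (Function.update (x r) (Sum.inr j) s)) =
      S.penalty c q x := by
  have h : ∀ r', (Function.update x r (Function.update (x r) (Sum.inr j) s) r').sens =
      (x r').sens := by
    intro r'
    by_cases hr : r' = r
    · subst hr
      simp [Strategy.sens]
    · simp [hr]
  simp only [penalty, h]

/-- Near `x` the payoff splits into a function of the own sensing time and false alarm probability,
a function of the powers, and one of the sensing times. Mixed derivatives between players survive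
only for two sensing times or two powers. -/
lemma hess_theta_eq_zero (hx : x ∈ S.convProd) (hq : (x q).pow ≠ 0) (hr : r ≠ q) (i j : Coord N)
    (hij : (i ≠ Sum.inl () ∨ j ≠ Sum.inl ()) ∧
      ∀ k l, i ≠ Sum.inr (Sum.inl k) ∨ j ≠ Sum.inr (Sum.inl l)) :
    hess (S.theta c q) q r x i j = 0 := by
  set A : Profile Q N → ℝ := fun x => Real.log (1 - (x q).sens ^ 2 / (S.f q * S.T q)) +
    Real.log (1 - (x q).fa) with hA
  set G : Profile Q N → ℝ := fun x => Real.log (S.sumRate q x) with hG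
  set P : Profile Q N → ℝ := fun x => -S.penalty c q x with hP
  have ht : ContDiffAt ℝ 2 (fun x : Profile Q N => 1 - (x q).sens ^ 2 / (S.f q * S.T q)) x :=
    contDiffAt_const.sub (((contDiff_sens q).pow 2).div_const _).contDiffAt
  have hf : ContDiffAt ℝ 2 (fun x : Profile Q N => 1 - (x q).fa) x :=
    contDiffAt_const.sub (contDiff_fa q).contDiffAt
  have hR := contDiffAt_sumRate hx q
  have ht0 := S.time_pos (hx q)
  have hf0 := sub_pos.2 (S.fa_lt_one (hx q))
  have hR0 := sumRate_pos hx hq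
  have hAc : ContDiffAt ℝ 2 A x := (ht.log ht0.ne').add (hf.log hf0.ne')
  have hGc : ContDiffAt ℝ 2 G x := hR.log hR0.ne'
  have hPc : ContDiffAt ℝ 2 P x := (contDiff_penalty c q).contDiffAt.neg
  have hev : S.theta c q =ᶠ[𝓝 x] fun y => A y + G y + P y := by
    filter_upwards [ht.continuousAt.eventually_ne ht0.ne', hf.continuousAt.eventually_ne hf0.ne',
      hR.continuousAt.eventually_ne hR0.ne'] with y h1 h2 h3
    rw [theta_eq, throughput_eq, Real.log_mul h1 (mul_ne_zero h2 h3), Real.log_mul h2 h3]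
    simp only [hA, hG, hP]
    ring
  have hsum := hess_add (hAc.add hGc) hPc q r
  rw [hess_congr hev (contDiffAt_theta hx hq c) q r, hsum, hess_add hAc hGc]
  have hA0 : hess A q r x i j = 0 := by
    refine hess_eq_zero_right (fun x s => ?_) x
    simp [hA, hr.symm]
  have hGl : (∀ k, i ≠ Sum.inr (Sum.inl k)) → hess G q r x i j = 0 := fun h =>
    hess_eq_zero_left hGc fun x s => by simp only [hG, sumRate_update_coord x q i s h]
  have hGr : (∀ k, j ≠ Sum.inr (Sum.inl k)) → hess G q r x i j = 0 := fun h =>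
    hess_eq_zero_right (fun x s => by simp only [hG, sumRate_update_coord x r j s h]) x
  have hPl : i ≠ Sum.inl () → hess P q r x i j = 0 := by
    rcases i with ⟨⟩ | i
    · exact fun h => absurd rfl h
    · exact fun _ => hess_eq_zero_left hPc fun x s => by simp only [hP, penalty_update_coord]
  have hPr : j ≠ Sum.inl () → hess P q r x i j = 0 := by
    rcases j with ⟨⟩ | j
    · exact fun h => absurd rfl h
    · exact fun _ => hess_eq_zero_right (fun x s => by simp only [hP, penalty_update_coord]) x
  have hG0 : hess G q r x i j = 0 := by
    by_cases hi : ∃ k, i = Sum.inr (Sum.inl k)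
    · obtain ⟨k, rfl⟩ := hi
      exact hGr fun l => (hij.2 k l).resolve_left fun h => h rfl
    · exact hGl (not_exists.1 hi)
  simp only [Matrix.add_apply]
  rw [hA0, hG0, hij.1.elim hPl hPr]
  simp

lemma norm_pow_le_tailNorm (a : Strategy N) : ‖WithLp.toLp 2 a.pow‖ ≤ tailNorm a := by
  refine (pow_le_pow_iff_left₀ (norm_nonneg _) (tailNorm_nonneg a) two_ne_zero).1 ?_
  rw [tailNorm, EuclideanSpace.real_norm_sq_eq, EuclideanSpace.real_norm_sq_eq,
    Fintype.sum_sum_type]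
  exact le_add_of_nonneg_right (Finset.sum_nonneg fun _ _ => sq_nonneg _)

lemma hess_theta_bilin_le (hx : x ∈ S.convProd) (hq : (x q).pow ≠ 0) (hr : r ≠ q)
    (a b : Strategy N) :
    a ⬝ᵥ (hess (S.theta c q) q r x).mulVec b ≤
      ![|a (Sum.inl ())|, tailNorm a] ⬝ᵥ
        (S.Emat c q r x).mulVec ![|b (Sum.inl ())|, tailNorm b] := by
  set A := hess (S.theta c q) q r x with hA
  set A' := A.submatrix (fun k : Fin N => Sum.inr (Sum.inl k))
    (fun k : Fin N => Sum.inr (Sum.inl k)) with hA'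
  have h0 := hess_theta_eq_zero (c := c) hx hq hr
  rw [← hA] at h0
  have hexp : a ⬝ᵥ A.mulVec b = a (Sum.inl ()) * (A (Sum.inl ()) (Sum.inl ()) * b (Sum.inl ())) +
      a.pow ⬝ᵥ A'.mulVec b.pow := by
    simp only [dotProduct, Matrix.mulVec, Fintype.sum_sum_type, Finset.univ_unique,
      Finset.sum_singleton, PUnit.default_eq_unit]
    have z1 : ∀ k, A (Sum.inl ()) (Sum.inr (Sum.inl k)) = 0 := fun k => h0 _ _ (by simp)
    have z2 : A (Sum.inl ()) (Sum.inr (Sum.inr ())) = 0 := h0 _ _ (by simp)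
    have z3 : ∀ k, A (Sum.inr (Sum.inl k)) (Sum.inl ()) = 0 := fun k => h0 _ _ (by simp)
    have z4 : ∀ k, A (Sum.inr (Sum.inl k)) (Sum.inr (Sum.inr ())) = 0 := fun k => h0 _ _ (by simp)
    have z5 : ∀ j, A (Sum.inr (Sum.inr ())) j = 0 := fun k => h0 _ _ (by simp)
    simp only [z1, z2, z3, z4, z5, zero_mul, Finset.sum_const_zero, add_zero, zero_add, mul_zero]
    rfl
  have hE : S.Emat c q r x = Matrix.diagonal ![|A (Sum.inl ()) (Sum.inl ())|, specNorm A'] := rfl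
  rw [hexp, hE]
  simp only [dotProduct, Fin.sum_univ_two, Matrix.mulVec_diagonal, Matrix.cons_val_zero,
    Matrix.cons_val_one]
  refine add_le_add ?_ ?_
  · rw [← abs_mul, ← abs_mul]
    exact le_abs_self _
  · have h1 := norm_pow_le_tailNorm a
    have h2 := norm_pow_le_tailNorm b
    have h3 := specNorm_nonneg A'
    have h4 := tailNorm_nonneg a
    calc _ ≤ _ := (le_abs_self _).trans (abs_dotProduct_mulVec_le A' a.pow b.pow)
      _ ≤ _ := by gcongr

/-- Continuity of second derivatives on a compact set makes the supremum in `betaCoef` an actual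
upper bound. -/
lemma bddAbove_beta [NeZero N] :
    BddAbove ((fun x => specNorm ((S.Dmat c t pRef q)⁻¹ * S.Emat c q r x *
      (S.Dmat c t pRef r)⁻¹)) '' S.profilesLow t pRef q) := by
  refine isCompact_profilesLow.bddAbove_image fun x hx => ContinuousAt.continuousWithinAt ?_
  have hA := continuousAt_hess (contDiffAt_theta (profilesLow_subset hx)
    (pow_ne_zero_of_mem_low hx.1) c) q r
  have hc : Continuous fun A : Matrix (Coord N) (Coord N) ℝ =>
      specNorm ((S.Dmat c t pRef q)⁻¹ * Matrix.diagonal ![|A (Sum.inl ()) (Sum.inl ())|,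
        specNorm (A.submatrix (fun k : Fin N => Sum.inr (Sum.inl k))
        (fun k : Fin N => Sum.inr (Sum.inl k)))] * (S.Dmat c t pRef r)⁻¹) := by
    refine continuous_specNorm.comp (Continuous.matrix_mul (Continuous.matrix_mul
      continuous_const (Continuous.matrix_diagonal (continuous_pi fun i => ?_))) continuous_const)
    fin_cases i
    · exact ((continuous_id.matrix_elem _ _)).abs
    · exact continuous_specNorm.comp (continuous_id.matrix_submatrix _ _)
  exact hc.continuousAt.comp hA

lemma betaCoef_nonneg : 0 ≤ S.betaCoef c t pRef q r := by
  refine Real.sSup_nonneg ?_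
  rintro _ ⟨x, -, rfl⟩
  exact specNorm_nonneg _

lemma hess_theta_bilin_le_beta [NeZero N] (hD : ∀ q, IsUnit (S.Dmat c t pRef q))
    (hx : x ∈ S.profilesLow t pRef q) (hr : r ≠ q) (a b : Strategy N) :
    a ⬝ᵥ (hess (S.theta c q) q r x).mulVec b ≤
      S.stratNorm c t pRef q a * (S.betaCoef c t pRef q r * S.stratNorm c t pRef r b) := by
  refine (hess_theta_bilin_le (profilesLow_subset hx) (pow_ne_zero_of_mem_low hx.1) hr
    a b).trans ?_
  set u : Fin 2 → ℝ := ![|a (Sum.inl ())|, tailNorm a] with hu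
  set v : Fin 2 → ℝ := ![|b (Sum.inl ())|, tailNorm b] with hv
  have hq := (Matrix.isUnit_iff_isUnit_det _).1 (hD q)
  have hr' := (Matrix.isUnit_iff_isUnit_det _).1 (hD r)
  have hsymm : (S.Dmat c t pRef q).transpose = S.Dmat c t pRef q := by
    simp [Dmat]
  -- Inserting `D⁻¹ D` on both sides turns the plain norms into the norms of the two players.
  have heq : u ⬝ᵥ (S.Emat c q r x).mulVec v = (S.Dmat c t pRef q).mulVec u ⬝ᵥ
      ((S.Dmat c t pRef q)⁻¹ * S.Emat c q r x * (S.Dmat c t pRef r)⁻¹).mulVec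
        ((S.Dmat c t pRef r).mulVec v) := by
    rw [Matrix.mulVec_mulVec, Matrix.mul_assoc, Matrix.nonsing_inv_mul _ hr', Matrix.mul_one,
      ← Matrix.vecMul_transpose (S.Dmat c t pRef q) u, hsymm, ← Matrix.dotProduct_mulVec, Matrix.mulVec_mulVec,
      ← Matrix.mul_assoc, Matrix.mul_nonsing_inv _ hq, Matrix.one_mul]
  rw [heq]
  refine (le_abs_self _).trans ((abs_dotProduct_mulVec_le _ _ _).trans ?_)
  refine mul_le_mul_of_nonneg_left ?_ (norm_nonneg _)
  refine mul_le_mul_of_nonneg_right ?_ (norm_nonneg _)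
  exact le_csSup (bddAbove_beta) ⟨x, hx, rfl⟩

/-- Lipschitz estimate for the best response of one player. -/
lemma IsOptimal.stratNorm_sub_le [NeZero N] [NeZero Q] (hc : 0 ≤ c)
    (hD : ∀ q, IsUnit (S.Dmat c t pRef q)) (hprice : 0 ≤ price) (hpt : price ≤ t)
    (hp : S.IsRefPower q (pRef q)) {x' : Profile Q N}
    (hx : ∀ r, r ≠ q → x r ∈ S.convSet r) (hx' : ∀ r, r ≠ q → x' r ∈ S.convSet r)
    {y y' : Strategy N} (hy : S.IsOptimal c price q x y) (hy' : S.IsOptimal c price q x' y') :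
    S.stratNorm c t pRef q (y' - y) ≤
      ∑ r ∈ Finset.univ.erase q, S.betaCoef c t pRef q r * S.stratNorm c t pRef r (x' r - x r) := by
  have hρ := rho_pos (hD q)
  have hlow := hy.mem_convSetLow hprice hpt hx hp
  have hlow' := hy'.mem_convSetLow hprice hpt hx' hp
  -- The strategy set of `q` does not depend on the opponents, so each optimum is feasible in the
  -- other problem.
  have h1 := hy.cost_add_sq_le hc hρ hprice hpt hx hp hlow' hy'.1.2
  have h2 := hy'.cost_add_sq_le hc hρ hprice hpt hx' hp hlow hy.1.2
  have hneg : S.stratNorm c t pRef q (y - y') ^ 2 = S.stratNorm c t pRef q (y' - y) ^ 2 := by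
    have ht : tailNorm (y - y') = tailNorm (y' - y) := by
      have : (fun j : Fin N ⊕ Unit => (y - y') (Sum.inr j)) =
          -fun j : Fin N ⊕ Unit => (y' - y) (Sum.inr j) := by
        funext j
        simp
      rw [tailNorm, this, WithLp.toLp_neg, norm_neg, tailNorm]
    rw [stratNorm_sq hc, stratNorm_sq hc, ht]
    simp only [Pi.sub_apply]
    ring
  rw [hneg] at h2
  have g1 := globInt_update_sub (S := S) q x y' y
  have g2 := globInt_update_sub (S := S) q x' y' y
  have hg : S.globInt (Function.update x q y') - S.globInt (Function.update x q y) =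
      S.globInt (Function.update x' q y') - S.globInt (Function.update x' q y) := g1.trans g2.symm
  have hgp := congrArg (fun s => price * s) hg
  simp only [mul_sub] at hgp
  simp only [cost] at h1 h2
  set a : Profile Q N := Pi.single q (y' - y) with ha
  -- The displacement of the opponents; its component at `q` is zero, so it can be combined freely
  -- with the own displacement `a`.
  set b : Profile Q N := ∑ r ∈ Finset.univ.erase q, Pi.single r (x' r - x r) with hb
  have hbr : ∀ r, b r = if r = q then 0 else x' r - x r := by
    intro r
    rw [hb, Finset.sum_apply]
    by_cases hr : r = q
    · rw [if_pos hr]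
      refine Finset.sum_eq_zero fun r' hr' => ?_
      rw [Pi.single_eq_of_ne]
      exact hr ▸ (Finset.ne_of_mem_erase hr').symm
    · rw [if_neg hr, Finset.sum_eq_single r]
      · simp
      · intro r' _ hne
        rw [Pi.single_eq_of_ne hne.symm]
      · intro hn
        exact absurd (Finset.mem_erase.2 ⟨hr, Finset.mem_univ r⟩) hn
  set X := Function.update x q y with hX
  have e1 : X + a = Function.update x q y' := update_add_single x q y y'
  have hshift : ∀ (z : Strategy N) (s : ℝ), Function.update x q z + s • b =
      Function.update (fun r => (1 - s) • x r + s • x' r) q z := by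
    intro z s
    funext r
    by_cases hr : r = q
    · subst hr; simp [hbr]
    · simp only [Pi.add_apply, Pi.smul_apply, hbr, if_neg hr, Function.update_of_ne hr]
      module
  have hshift1 : ∀ z : Strategy N, Function.update x q z + b = Function.update x' q z := by
    intro z
    have := hshift z 1
    simpa using this
  have hpoint : ∀ u ∈ Icc (0 : ℝ) 1, ∀ s ∈ Icc (0 : ℝ) 1,
      X + u • a + s • b ∈ S.profilesLow t pRef q := by
    intro u hu s hs
    rw [hX, ha, update_add_smul, hshift]
    refine update_mem_profilesLow (fun r hr => ?_)
      (convex_convSetLow hlow hlow' (sub_nonneg.2 hu.2) hu.1 (by ring))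
    exact S.convex_convSet r (hx r hr) (hx' r hr) (sub_nonneg.2 hs.2) hs.1 (by ring)
  have hsmooth : ∀ u ∈ Icc (0 : ℝ) 1, ∀ s ∈ Icc (0 : ℝ) 1,
      ContDiffAt ℝ 2 (S.theta c q) (X + u • a + s • b) := fun u hu s hs =>
    contDiffAt_theta (profilesLow_subset (hpoint u hu s hs))
      (pow_ne_zero_of_mem_low (hpoint u hu s hs).1) c
  obtain ⟨u, hu, s, hs, hmix⟩ := exists_mixed_difference_eq hsmooth
  rw [e1, hshift1, hX, hshift1] at hmix
  have hexp : fderiv ℝ (fderiv ℝ (S.theta c q)) (X + u • a + s • b) a b ≤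
      S.stratNorm c t pRef q (y' - y) * ∑ r ∈ Finset.univ.erase q,
        S.betaCoef c t pRef q r * S.stratNorm c t pRef r (x' r - x r) := by
    conv_lhs => rw [hb, map_sum, ← hb]
    rw [Finset.mul_sum]
    refine Finset.sum_le_sum fun r hr => ?_
    rw [ha, fderiv_fderiv_single (hsmooth u hu s hs)]
    exact hess_theta_bilin_le_beta hD (hpoint u hu s hs) (Finset.ne_of_mem_erase hr) _ _
  have hkey : S.stratNorm c t pRef q (y' - y) ^ 2 ≤
      S.stratNorm c t pRef q (y' - y) * ∑ r ∈ Finset.univ.erase q,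
        S.betaCoef c t pRef q r * S.stratNorm c t pRef r (x' r - x r) := by
    -- The sum of the two growth inequalities: the squared distance is at most the mixed difference
    -- of `theta`, the price terms cancelling by `hgp`.
    refine le_trans ?_ hexp
    rw [← hX] at hmix
    rw [← hmix]
    linarith
  rcases (stratNorm_nonneg (S := S) (c := c) (t := t) (pRef := pRef) (q := q)
    (y' - y)).eq_or_lt with h0 | h0
  · rw [← h0]
    exact Finset.sum_nonneg fun r _ => mul_nonneg betaCoef_nonneg (stratNorm_nonneg _)
  · rw [sq] at hkey
    exact le_of_mul_le_mul_left hkey h0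

end System

end CognitiveRadio

/-! ### Contractions, weights and fixed points -/

namespace CognitiveRadio

open Set Filter Topology

/-- A map of a compact set that contracts the distance pulled back by an injective linear map has
a fixed point. -/
lemma exists_fixedPoint_of_contracting {E F : Type*} [NormedAddCommGroup E] [NormedSpace ℝ E]
    [NormedAddCommGroup F] [NormedSpace ℝ F] (T : E →L[ℝ] F) (hT : ∀ x, T x = 0 → x = 0)
    {Y : Set E} (hY : IsCompact Y) (hne : Y.Nonempty) {B : E → E} (hB : MapsTo B Y Y) {κ : ℝ}
    (hκ : κ < 1) (h : ∀ x ∈ Y, ∀ y ∈ Y, ‖T (B x - B y)‖ ≤ κ * ‖T (x - y)‖) :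
    ∃ x ∈ Y, B x = x := by
  have hcont : ContinuousOn (fun x => T (B x)) Y := by
    intro x hx
    rw [ContinuousWithinAt, tendsto_iff_norm_sub_tendsto_zero]
    have h0 : Tendsto (fun y => κ * ‖T (y - x)‖) (𝓝[Y] x) (𝓝 0) := by
      have hc : Continuous fun y => κ * ‖T (y - x)‖ := by fun_prop
      have := (hc.tendsto x).mono_left (nhdsWithin_le_nhds (s := Y))
      simpa using this
    refine squeeze_zero' (Eventually.of_forall fun y => norm_nonneg _) ?_ h0
    filter_upwards [self_mem_nhdsWithin] with y hy
    rw [← map_sub]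
    exact h y hy x hx
  -- At a minimizer of the residual, one more application of `B` multiplies the residual by at most
  -- `κ < 1`, so it must vanish.
  obtain ⟨x, hx, hmin⟩ := hY.exists_isMinOn hne
    (f := fun x => ‖T (B x) - T x‖) (hcont.sub T.continuous.continuousOn).norm
  refine ⟨x, hx, ?_⟩
  have h1 : ‖T (B x) - T x‖ ≤ ‖T (B (B x)) - T (B x)‖ := hmin (hB hx)
  have h2 := h (B x) (hB hx) x hx
  rw [map_sub, map_sub] at h2
  have h3 : ‖T (B x) - T x‖ = 0 := by
    nlinarith [norm_nonneg (T (B x) - T x)]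
  rw [norm_eq_zero, ← map_sub] at h3
  exact sub_eq_zero.1 (hT _ h3)

namespace System

variable {Q N : ℕ} {S : System Q N} {c t price : ℝ} {pRef : Fin Q → Fin N → ℝ}
  {v : Fin Q → ℝ}

lemma blockNorm_eq (y : Profile Q N) :
    S.blockNorm c t pRef v y = ⨆ q, S.stratNorm c t pRef q (y q) / v q := rfl

lemma stratNorm_le_blockNorm (hv : ∀ q, 0 < v q) (q : Fin Q) (y : Profile Q N) :
    S.stratNorm c t pRef q (y q) ≤ v q * S.blockNorm c t pRef v y := by
  rw [mul_comm, ← div_le_iff₀ (hv q), blockNorm_eq]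
  exact le_ciSup (f := fun q => S.stratNorm c t pRef q (y q) / v q)
    (Set.finite_range _).bddAbove q

lemma blockNorm_nonneg (hv : ∀ q, 0 < v q) (y : Profile Q N) : 0 ≤ S.blockNorm c t pRef v y :=
  Real.iSup_nonneg fun q => div_nonneg (stratNorm_nonneg _) (hv q).le

/-- The norm `blockNorm` is induced by a linear map into a product of Euclidean spaces. -/
lemma exists_linear_norm_eq_blockNorm [NeZero Q] (hc : 0 ≤ c) (hv : ∀ q, 0 < v q) :
    ∃ T : Profile Q N →L[ℝ] (Fin Q → EuclideanSpace ℝ (Coord N)),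
      ∀ y, ‖T y‖ = S.blockNorm c t pRef v y := by
  -- Rescaling coordinates by the diagonal of `D_q` over `v q` gives the block norm, because the
  -- tail coordinates share a single weight.
  let w : Fin Q → Coord N → ℝ := fun q =>
    Sum.elim (fun _ => √(S.rho t pRef q + c * ((1 - 1 / (Q : ℝ)) / √(S.f q)) ^ 2) / v q)
      fun _ => √(S.rho t pRef q) / v q
  let T : Profile Q N →ₗ[ℝ] (Fin Q → EuclideanSpace ℝ (Coord N)) :=
    { toFun := fun y q => WithLp.toLp 2 fun i => w q i * y q i
      map_add' := fun y z => by ext q i; simp [mul_add]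
      map_smul' := fun a y => by ext q i; simp; ring }
  have hT : ∀ y q, ‖T y q‖ = S.stratNorm c t pRef q (y q) / v q := by
    intro y q
    have hρ : 0 ≤ S.rho t pRef q := rho_nonneg
    refine (sq_eq_sq₀ (norm_nonneg _) (div_nonneg (stratNorm_nonneg _) (hv q).le)).1 ?_
    rw [div_pow, stratNorm_sq hc, tailNorm, EuclideanSpace.real_norm_sq_eq,
      EuclideanSpace.real_norm_sq_eq, Fintype.sum_sum_type]
    simp only [Finset.univ_unique, Finset.sum_singleton, PUnit.default_eq_unit, T, w,
      LinearMap.coe_mk, AddHom.coe_mk, Sum.elim_inl, Sum.elim_inr, mul_pow, div_pow,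
      ← Finset.mul_sum]
    rw [Real.sq_sqrt (by positivity), Real.sq_sqrt hρ]
    ring
  refine ⟨LinearMap.toContinuousLinearMap T, fun y => ?_⟩
  rw [blockNorm_eq]
  refine le_antisymm ?_ (ciSup_le fun q => ?_)
  · refine (pi_norm_le_iff_of_nonneg
      (blockNorm_nonneg (S := S) (c := c) (t := t) (pRef := pRef) hv y)).2 fun q => ?_
    refine (hT y q).le.trans ?_
    exact le_ciSup (f := fun q => S.stratNorm c t pRef q (y q) / v q)
      (Set.finite_range _).bddAbove q
  · rw [← hT]
    exact norm_le_pi_norm (T y) q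

lemma eq_zero_of_blockNorm (hc : 0 ≤ c) (hD : ∀ q, IsUnit (S.Dmat c t pRef q))
    (hv : ∀ q, 0 < v q) {y : Profile Q N} (h : S.blockNorm c t pRef v y = 0) : y = 0 := by
  funext q
  refine eq_zero_of_stratNorm hc (rho_pos (hD q)) (le_antisymm ?_ (stratNorm_nonneg _))
  have := stratNorm_le_blockNorm (S := S) (c := c) (t := t) (pRef := pRef) hv q y
  rwa [h, mul_zero] at this

/-- Weights for which the row sums of the coefficients `β_{qr}` are uniformly below one. -/
lemma exists_weights [NeZero Q] (hGamma : IsPMatrix (S.Gamma c t pRef)) :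
    ∃ v : Fin Q → ℝ, (∀ q, 0 < v q) ∧ ∃ κ : ℝ, 0 ≤ κ ∧ κ < 1 ∧
      ∀ q, ∑ r ∈ Finset.univ.erase q, S.betaCoef c t pRef q r * v r ≤ κ * v q := by
  obtain ⟨v, hv, hv'⟩ := hGamma.exists_pos_mulVec_pos fun q r hqr => by
    simp only [Gamma, Matrix.of_apply, if_neg hqr.symm]
    exact neg_nonpos.2 betaCoef_nonneg
  have hrow : ∀ q, (S.Gamma c t pRef).mulVec v q =
      v q - ∑ r ∈ Finset.univ.erase q, S.betaCoef c t pRef q r * v r := by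
    intro q
    rw [Matrix.mulVec, dotProduct, ← Finset.add_sum_erase _ _ (Finset.mem_univ q), sub_eq_add_neg,
      ← Finset.sum_neg_distrib]
    congr 1
    · simp [Gamma]
    · refine Finset.sum_congr rfl fun r hr => ?_
      simp [Gamma, Finset.ne_of_mem_erase hr]
  set s : Fin Q → ℝ := fun q =>
    (∑ r ∈ Finset.univ.erase q, S.betaCoef c t pRef q r * v r) / v q with hs
  have hs0 : ∀ q, 0 ≤ s q := fun q => div_nonneg
    (Finset.sum_nonneg fun r _ => mul_nonneg betaCoef_nonneg (hv r).le) (hv q).le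
  -- Positivity of `Γ v` says that each ratio `s q` is below 1; with finitely many players their
  -- supremum is attained, hence also below 1.
  refine ⟨v, hv, ⨆ q, s q, Real.iSup_nonneg hs0, ?_, fun q => ?_⟩
  · obtain ⟨q, hq⟩ := exists_eq_ciSup_of_finite (f := s)
    rw [← hq, hs, div_lt_one (hv q)]
    have := hv' q
    rw [hrow] at this
    linarith
  · rw [← div_le_iff₀ (hv q)]
    exact le_ciSup (f := s) (Set.finite_range _).bddAbove q

end System

end CognitiveRadio

theorem theorem3 {Q N : ℕ} [NeZero Q] [NeZero N] (S : CognitiveRadio.System Q N)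
    (c t price : ℝ) (hc : 0 ≤ c) (ht : 0 < t) (hprice : 0 ≤ price) (hpt : price ≤ t)
    (hX : ∀ q, (S.stratSet q).Nonempty)
    (pRef : Fin Q → Fin N → ℝ) (hpRef : ∀ q, S.IsRefPower q (pRef q))
    (hsens : c = 0 ∨ ((∀ q r, S.tauMin q = S.tauMin r ∧ S.tauMax q = S.tauMax r) ∧
      ∀ q, S.faRef q ≤ S.beta q))
    (hD : ∀ q, IsUnit (S.Dmat c t pRef q))
    (hGamma : CognitiveRadio.IsPMatrix (S.Gamma c t pRef)) :
    (∀ (q : Fin Q) (x : CognitiveRadio.Profile Q N), (∀ r, r ≠ q → x r ∈ S.convSet r) →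
      (∃! y, S.IsOptimal c price q x y) ∧
        ∀ y, S.IsOptimal c price q x y → y.pow ≠ 0) ∧
    ∃ B : CognitiveRadio.Profile Q N → CognitiveRadio.Profile Q N,
      (∀ x ∈ S.convProd, ∀ q, S.IsOptimal c price q x (B x q)) ∧
      (∃ v : Fin Q → ℝ, (∀ q, 0 < v q) ∧ ∃ κ : ℝ, 0 ≤ κ ∧ κ < 1 ∧
        ∀ x ∈ S.convProd, ∀ y ∈ S.convProd,
          S.blockNorm c t pRef v (B x - B y) ≤ κ * S.blockNorm c t pRef v (x - y)) ∧
      ∃ xStar ∈ S.convProd, B xStar = xStar ∧ (∀ x ∈ S.convProd, B x = x → x = xStar) ∧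
        ∀ x, S.IsNash c price x ↔ x = xStar := by
  have huniq : ∀ (q : Fin Q) (x : CognitiveRadio.Profile Q N), (∀ r, r ≠ q → x r ∈ S.convSet r) →
      ∀ y z, S.IsOptimal c price q x y → S.IsOptimal c price q x z → z = y :=
    fun q x hx y z hy hz => hy.unique hc (CognitiveRadio.System.rho_pos (hD q)) hz hprice hpt hx
      (hpRef q)
  refine ⟨fun q x hx => ⟨?_, fun y hy => hy.pow_ne_zero hx (hpRef q)⟩, ?_⟩
  · obtain ⟨y, hy⟩ := CognitiveRadio.System.exists_isOptimal (c := c) (price := price) hx (hX q)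
    exact ⟨y, hy, fun z hz => huniq q x hx y z hy hz⟩
  -- Best responses are chosen on `Y`; outside `Y` the value of the map is irrelevant.
  have hex : ∀ x : CognitiveRadio.Profile Q N, ∃ b : CognitiveRadio.Profile Q N,
      x ∈ S.convProd → ∀ q, S.IsOptimal c price q x (b q) := by
    intro x
    by_cases hx : x ∈ S.convProd
    · choose b hb using fun q => CognitiveRadio.System.exists_isOptimal (c := c) (price := price)
        (fun r (_ : r ≠ q) => hx r) (hX q)
      exact ⟨b, fun _ => hb⟩
    · exact ⟨x, fun h => absurd h hx⟩
  choose B hB using hex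
  obtain ⟨v, hv, κ, hκ0, hκ1, hrow⟩ := CognitiveRadio.System.exists_weights hGamma
  have hcontr : ∀ x ∈ S.convProd, ∀ y ∈ S.convProd,
      S.blockNorm c t pRef v (B x - B y) ≤ κ * S.blockNorm c t pRef v (x - y) := by
    intro x hx y hy
    rw [CognitiveRadio.System.blockNorm_eq]
    refine ciSup_le fun q => ?_
    rw [div_le_iff₀ (hv q)]
    refine ((hB y hy q).stratNorm_sub_le hc hD hprice hpt (hpRef q) (fun r _ => hy r)
      (fun r _ => hx r) (hB x hx q)).trans ?_
    calc _ ≤ ∑ r ∈ Finset.univ.erase q, S.betaCoef c t pRef q r *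
          (v r * S.blockNorm c t pRef v (x - y)) := by
          gcongr with r
          · exact CognitiveRadio.System.betaCoef_nonneg
          · exact CognitiveRadio.System.stratNorm_le_blockNorm hv r (x - y)
      _ = (∑ r ∈ Finset.univ.erase q, S.betaCoef c t pRef q r * v r) *
          S.blockNorm c t pRef v (x - y) := by
          rw [Finset.sum_mul]
          exact Finset.sum_congr rfl fun r _ => by ring
      _ ≤ κ * v q * S.blockNorm c t pRef v (x - y) :=
          mul_le_mul_of_nonneg_right (hrow q) (CognitiveRadio.System.blockNorm_nonneg hv _)
      _ = _ := by ring
  have hmaps : Set.MapsTo B S.convProd S.convProd := fun x hx q => (hB x hx q).1.1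
  have hcompact : IsCompact S.convProd := by
    have h : S.convProd = Set.pi Set.univ S.convSet := by
      ext x
      simp [CognitiveRadio.System.convProd]
    rw [h]
    exact isCompact_univ_pi fun q => S.isCompact_convSet q
  have hne : S.convProd.Nonempty := ⟨fun q => (hX q).some, fun q => (hX q).some_mem.1⟩
  obtain ⟨T, hT⟩ := CognitiveRadio.System.exists_linear_norm_eq_blockNorm (S := S) (t := t)
    (pRef := pRef) hc hv
  obtain ⟨xStar, hxS, hfix⟩ := CognitiveRadio.exists_fixedPoint_of_contracting T
    (fun x hx => CognitiveRadio.System.eq_zero_of_blockNorm hc hD hv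
      (by rw [← hT, hx, norm_zero])) hcompact hne hmaps hκ1
    (fun x hx y hy => by rw [hT, hT]; exact hcontr x hx y hy)
  have hfixed : ∀ x ∈ S.convProd, B x = x → x = xStar := by
    intro x hx hBx
    have h1 := hcontr x hx xStar hxS
    rw [hBx, hfix] at h1
    have h2 := CognitiveRadio.System.blockNorm_nonneg (S := S) (c := c) (t := t) (pRef := pRef) hv
      (x - xStar)
    have h3 : S.blockNorm c t pRef v (x - xStar) = 0 := by nlinarith
    exact sub_eq_zero.1 (CognitiveRadio.System.eq_zero_of_blockNorm hc hD hv h3)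
  refine ⟨B, hB, ⟨v, hv, κ, hκ0, hκ1, hcontr⟩, xStar, hxS, hfix, hfixed, fun x => ⟨?_, ?_⟩⟩
  -- An equilibrium lies in `Y` and, by uniqueness of best responses, is fixed by `B`.
  · intro hN
    have hx : x ∈ S.convProd := fun q => (hN q).1.1
    exact hfixed x hx (funext fun q => huniq q x (fun r _ => hx r) _ _ (hN q) (hB x hx q))
  · rintro rfl q
    have := hB x hxS q
    rwa [hfix] at this
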